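/- Let $\mathbf k$ be a field of characteristic zero and $V$ a $\mathbf k$-vector space. A *rooted tree* is a finite tree with a distinguished vertex (the root), all edges being oriented towards the root; the *arity* of a vertex is the number of its incoming edges. Let $\mathrm{Tr}_n$ be the set of rooted trees with vertices numbered $1,\dots,n$, and $\mathrm{Tr}^1_n$ the set of rooted trees with $n$ vertices numbered $1,\dots,n$ and one additional, *special*, vertex $\circ$. The symmetric group $\Sigma_n$ acts on both by relabelling. Put $$\mathrm{Tr}(V)=\bigoplus_{n\ge 1}\mathrm{Span}_{\mathbf k}(\mathrm{Tr}_n)\otimes_{\Sigma_n}V^{\otimes n},\qquad \mathrm{Tr}^1(V)=\bigoplus_{n\ge 0}\mathrm{Span}_{\mathbf k}(\mathrm{Tr}^1_n)\otimes_{\Sigma_n}V^{\otimes n},$$ the spaces of rooted trees (respectively, rooted trees with one special vertex) whose (nonspecial) vertices are decorated by elements of $V$. An edge $e$ of $S\in\mathrm{Tr}^1_n$ is *special* if it is adjacent to $\circ$; then $S/e\in\mathrm{Tr}_n$ denotes the tree obtained by contracting $e$ to a vertex labelled by the endpoint of $e$ different from $\circ$. A *blow-up* of $T\in\mathrm{Tr}_n$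 is a pair $(S,e)$ of $S\in\mathrm{Tr}^1_n$ and a special edge $e$ of $S$ such that $S/e=T$ and $\circ$ has arity at least $2$ in $S$. Let $\mathrm{bl}(T)$ be the set of blow-ups of $T$, and let $\epsilon_{(S,e)}=+1$ if $e$ is an incoming edge of $\circ$ and $\epsilon_{(S,e)}=-1$ if $e$ is the outgoing edge of $\circ$. Let $\delta:\mathrm{Tr}(V)\to\mathrm{Tr}^1(V)$ be the linear map given, with the decorations carried along, by $$\delta(T)=\sum_{(S,e)\in \mathrm{bl}(T)}\epsilon_{(S,e)}\,S .$$ Finally, for decorated rooted trees $T,S$ let $T\star S\in\mathrm{Tr}(V)$ be the sum, over all vertices $a$ of $T$, of the trees obtained by joining the root of $S$ to $a$ by a new edge (the root being that of $T$), extended bilinearly. **Corollary.** There is an isomorphism of vector spaces, natural in $V$, $$\Phi_V:\ \mathsf L(V)\ \xrightarrow{\ \cong\ }\ \mathrm{Ker}\bigl(\delta:\mathrm{Tr}(V)\to\mathrm{Tr}^1(V)\bigr)$$ from the free Lie algebra $\mathsf L(V)$ on the vector space $V$. It sends each $v\in V$ to the one-vertex tree decorated by $v$, and it takes the Lie bracket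 to the commutator of $\star$, that is, $\Phi_V([x,y])=\Phi_V(x)\star\Phi_V(y)-\Phi_V(y)\star\Phi_V(x)$ for all $x,y\in\mathsf L(V)$. -/

import Mathlib

open scoped TensorProduct DirectSum

universe u v

noncomputable section

namespace LieTrees

/-! ### Rooted trees on a given vertex set -/

/-- A rooted tree with vertex set `α`, all edges being oriented towards the root: every vertex
other than the root has exactly one outgoing edge, which goes to `parent x`, and following the
outgoing edges leads from every vertex to the root. By convention `parent root = root` (this is not
an edge). -/
@[ext]
structure RTree (α : Type*) where
  root : α
  parent : α → α
  parent_root : parent root = root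
  reaches_root : ∀ x, ∃ m : ℕ, parent^[m] x = root

namespace RTree

variable {α β γ : Type*}

/-- `T.Edge a b`: there is an edge of `T` between `a` and `b`, oriented from `a` to `b`. -/
def Edge (T : RTree α) (a b : α) : Prop := a ≠ b ∧ T.parent a = b

/-- The arity of a vertex: the number of its incoming edges. -/
def arity (T : RTree α) (b : α) : ℕ := Set.ncard {a | T.Edge a b}

/-- Renaming the vertices of a tree along a bijection. -/
@[simps]
def relabel (e : α ≃ β) (T : RTree α) : RTree β where
  root := e T.root
  parent b := e (T.parent (e.symm b))
  parent_root := by simp [T.parent_root]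
  reaches_root b := by
    obtain ⟨m, hm⟩ := T.reaches_root (e.symm b)
    refine ⟨m, ?_⟩
    have key : ∀ (j : ℕ) (x : α),
        (fun b => e (T.parent (e.symm b)))^[j] (e x) = e (T.parent^[j] x) := by
      intro j
      induction j with
      | zero => intro x; rfl
      | succ j ih => intro x; simp [Function.iterate_succ_apply, ih]
    have := key m (e.symm b)
    rw [Equiv.apply_symm_apply] at this
    rw [this, hm]

@[simp] theorem relabel_refl (T : RTree α) : T.relabel (Equiv.refl α) = T := by
  ext <;> simp

theorem relabel_relabel (e : α ≃ β) (f : β ≃ γ) (T : RTree α) :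
    (T.relabel e).relabel f = T.relabel (e.trans f) := by
  ext <;> simp

/-- Renaming of vertices as a bijection between sets of trees. -/
def relabelEquiv (e : α ≃ β) : RTree α ≃ RTree β where
  toFun := relabel e
  invFun := relabel e.symm
  left_inv T := by simp [relabel_relabel]
  right_inv T := by simp [relabel_relabel]

@[simp] theorem edge_relabel (e : α ≃ β) (T : RTree α) (a b : α) :
    (T.relabel e).Edge (e a) (e b) ↔ T.Edge a b := by
  simp [Edge]

theorem arity_relabel (e : α ≃ β) (T : RTree α) (b : α) :
    (T.relabel e).arity (e b) = T.arity b := by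
  unfold arity
  rw [← Set.ncard_image_of_injective _ e.injective]
  congr 1
  ext c
  obtain ⟨a, rfl⟩ := e.surjective c
  simp

instance [Finite α] : Finite (RTree α) :=
  Finite.of_injective (fun T : RTree α => (T.root, T.parent)) (by
    intro S T h
    simp only [Prod.mk.injEq] at h
    exact RTree.ext h.1 h.2)

instance [Finite α] : Fintype (RTree α) := Fintype.ofFinite _

/-- The symmetric group acts on trees by relabelling the vertices. -/
instance : MulAction (Equiv.Perm α) (RTree α) where
  smul σ T := T.relabel σ
  one_smul T := relabel_refl T
  mul_smul σ τ T := (relabel_relabel τ σ T).symm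

/-! Trees with one additional *special* vertex are trees with vertex set `Option α`, the special
vertex being `none`. -/

/-- The symmetric group acts on trees with a special vertex by relabelling the other vertices. -/
instance : MulAction (Equiv.Perm α) (RTree (Option α)) where
  smul σ T := T.relabel (Equiv.optionCongr σ)
  one_smul T := by
    change T.relabel (Equiv.optionCongr (Equiv.refl α)) = T
    simp
  mul_smul σ τ T := by
    change T.relabel (Equiv.optionCongr (τ.trans σ)) = (T.relabel _).relabel _
    rw [relabel_relabel, Equiv.optionCongr_trans]

theorem smul_def (σ : Equiv.Perm α) (T : RTree α) : σ • T = T.relabel σ := rfl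

theorem smul_def_option (σ : Equiv.Perm α) (S : RTree (Option α)) :
    σ • S = S.relabel (Equiv.optionCongr σ) := rfl

/-- The one-vertex tree. -/
def single (α : Type*) [Unique α] : RTree α where
  root := default
  parent x := x
  parent_root := rfl
  reaches_root _ := ⟨0, Subsingleton.elim _ _⟩

/-! ### Blow-ups -/

/-- There is a (necessarily unique) special edge of `S`, that is, an edge adjacent to the special
vertex, whose other endpoint is `x`. Special edges will be denoted by their endpoint `x`. -/
def IsSpecialEdge (S : RTree (Option α)) (x : α) : Prop :=
  S.Edge (some x) none ∨ S.Edge none (some x)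

/-- The map of vertices which merges the special vertex with the vertex `x`; the resulting vertex
carries the label `x`. -/
def collapse (x : α) (o : Option α) : α := o.getD x

/-- `T` is the quotient `S/e` obtained by contracting the special edge `e` of `S` whose nonspecial
endpoint is `x`. -/
def IsContraction (S : RTree (Option α)) (x : α) (T : RTree α) : Prop :=
  T.root = collapse x S.root ∧
    ∀ a b, T.Edge a b ↔ a ≠ b ∧ ∃ a' b', S.Edge a' b' ∧ collapse x a' = a ∧ collapse x b' = b

/-- The set of blow-ups of `T`: pairs of a tree `S` with a special vertex of arity at least `2` and
a special edge of `S` such that the contraction of this edge gives `T`. -/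
def blowUps (T : RTree α) : Set (RTree (Option α) × α) :=
  {p | IsSpecialEdge p.1 p.2 ∧ IsContraction p.1 p.2 T ∧ 2 ≤ p.1.arity none}

open Classical in
/-- The sign of a blow-up: `+1` if the special edge is an incoming edge of the special vertex and
`-1` if it is its outgoing edge. -/
def sign (p : RTree (Option α) × α) : ℤ := if p.1.Edge (some p.2) none then 1 else -1

theorem collapse_optionCongr (e : α ≃ β) (x : α) (o : Option α) :
    collapse (e x) (Equiv.optionCongr e o) = e (collapse x o) := by
  cases o <;> rfl

theorem edge_relabel_option (e : α ≃ β) (S : RTree (Option α)) (x : α) :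
    ((S.relabel (Equiv.optionCongr e)).Edge (some (e x)) none ↔ S.Edge (some x) none) ∧
      ((S.relabel (Equiv.optionCongr e)).Edge none (some (e x)) ↔ S.Edge none (some x)) :=
  ⟨edge_relabel (Equiv.optionCongr e) S (some x) none,
    edge_relabel (Equiv.optionCongr e) S none (some x)⟩

theorem isContraction_relabel (e : α ≃ β) (S : RTree (Option α)) (x : α) (T : RTree α) :
    IsContraction (S.relabel (Equiv.optionCongr e)) (e x) (T.relabel e) ↔ IsContraction S x T := by
  unfold IsContraction
  refine and_congr ?_ ?_
  · simp only [relabel_root, collapse_optionCongr, e.apply_eq_iff_eq]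
  · rw [e.forall_congr_left]
    refine forall_congr' fun a => ?_
    obtain ⟨a, rfl⟩ := e.surjective a
    rw [e.forall_congr_left]
    refine forall_congr' fun b => ?_
    obtain ⟨b, rfl⟩ := e.surjective b
    rw [e.symm_apply_apply, e.symm_apply_apply, edge_relabel, Ne, e.apply_eq_iff_eq]
    have : (∃ a' b', (S.relabel (Equiv.optionCongr e)).Edge a' b' ∧
          collapse (e x) a' = e a ∧ collapse (e x) b' = e b) ↔
        ∃ a' b', S.Edge a' b' ∧ collapse x a' = a ∧ collapse x b' = b := by
      constructor
      · rintro ⟨a', b', h, h1, h2⟩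
        obtain ⟨a', rfl⟩ := (Equiv.optionCongr e).surjective a'
        obtain ⟨b', rfl⟩ := (Equiv.optionCongr e).surjective b'
        rw [collapse_optionCongr, e.apply_eq_iff_eq] at h1 h2
        exact ⟨a', b', (edge_relabel _ _ _ _).1 h, h1, h2⟩
      · rintro ⟨a', b', h, rfl, rfl⟩
        exact ⟨_, _, (edge_relabel _ _ _ _).2 h, collapse_optionCongr e x a',
          collapse_optionCongr e x b'⟩
    rw [this]

theorem mem_blowUps_relabel (e : α ≃ β) (S : RTree (Option α)) (x : α) (T : RTree α) :
    (S.relabel (Equiv.optionCongr e), e x) ∈ blowUps (T.relabel e) ↔ (S, x) ∈ blowUps T := by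
  have h : (S.relabel (Equiv.optionCongr e)).arity none = S.arity none :=
    arity_relabel (Equiv.optionCongr e) S none
  simp only [blowUps, Set.mem_ofPred_eq, isContraction_relabel, IsSpecialEdge,
    (edge_relabel_option e S x).1, (edge_relabel_option e S x).2, h]

theorem sign_relabel (e : α ≃ β) (S : RTree (Option α)) (x : α) :
    sign (S.relabel (Equiv.optionCongr e), e x) = sign (S, x) := by
  unfold sign
  by_cases h : S.Edge (some x) none
  · rw [if_pos h, if_pos ((edge_relabel_option e S x).1.2 h)]
  · rw [if_neg h, if_neg (fun h' => h ((edge_relabel_option e S x).1.1 h'))]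

/-! ### Grafting -/

open Classical in
/-- The tree on the disjoint union of the vertices of `T` and `S` in which the root of `S` is
connected by a new edge with the vertex `a` of `T`; its root is the root of `T`. -/
@[simps]
def graft (T : RTree α) (a : α) (S : RTree β) : RTree (α ⊕ β) where
  root := Sum.inl T.root
  parent := Sum.elim (fun x => Sum.inl (T.parent x))
    (fun y => if y = S.root then Sum.inl a else Sum.inr (S.parent y))
  parent_root := by simp [T.parent_root]
  reaches_root := by
    set p : α ⊕ β → α ⊕ β := Sum.elim (fun x => Sum.inl (T.parent x))
      (fun y => if y = S.root then Sum.inl a else Sum.inr (S.parent y)) with hp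
    have hl : ∀ x : α, ∃ m : ℕ, p^[m] (Sum.inl x) = Sum.inl T.root := by
      intro x
      obtain ⟨m, hm⟩ := T.reaches_root x
      refine ⟨m, ?_⟩
      induction m generalizing x with
      | zero => exact congrArg Sum.inl hm
      | succ j ih =>
        rw [Function.iterate_succ_apply] at hm ⊢
        exact ih (T.parent x) hm
    have hr : ∀ (m : ℕ) (y : β), S.parent^[m] y = S.root →
        ∃ j : ℕ, p^[j] (Sum.inr y) = Sum.inl T.root := by
      intro m
      induction m with
      | zero =>
        intro y hy
        obtain ⟨j, hj⟩ := hl a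
        refine ⟨j + 1, ?_⟩
        rw [Function.iterate_succ_apply]
        have : p (Sum.inr y) = Sum.inl a := by
          simp only [hp, Sum.elim_inr]
          exact if_pos hy
        rw [this, hj]
      | succ m ih =>
        intro y hy
        by_cases h : y = S.root
        · obtain ⟨j, hj⟩ := hl a
          refine ⟨j + 1, ?_⟩
          rw [Function.iterate_succ_apply]
          have : p (Sum.inr y) = Sum.inl a := by
            simp only [hp, Sum.elim_inr]
            exact if_pos h
          rw [this, hj]
        · obtain ⟨j, hj⟩ := ih (S.parent y) hy
          refine ⟨j + 1, ?_⟩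
          rw [Function.iterate_succ_apply]
          have : p (Sum.inr y) = Sum.inr (S.parent y) := by
            simp only [hp, Sum.elim_inr]
            exact if_neg h
          rw [this, hj]
    rintro (x | y)
    · exact hl x
    · obtain ⟨m, hm⟩ := S.reaches_root y
      exact hr m y hm

theorem graft_relabel {α' β' : Type*} (e : α ≃ α') (f : β ≃ β') (T : RTree α) (a : α)
    (S : RTree β) :
    graft (T.relabel e) (e a) (S.relabel f) = (graft T a S).relabel (Equiv.sumCongr e f) := by
  ext z
  · simp
  · rcases z with x | y
    · simp
    · obtain ⟨y, rfl⟩ := f.surjective y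
      by_cases h : y = S.root <;> simp [h]

end RTree

/-! ### Decorated trees -/

section Decorated

variable (k : Type*) [CommRing k] (V W : Type*) [AddCommGroup V] [Module k V]
  [AddCommGroup W] [Module k W] (n : ℕ)
variable (X : Type*) [MulAction (Equiv.Perm (Fin n)) X]

/-- The action of the symmetric group on `V^{⊗ n}` by permutation of the factors. -/
def permTensor : Representation k (Equiv.Perm (Fin n)) (⨂[k] _ : Fin n, V) where
  toFun σ := (PiTensorProduct.reindex k (fun _ : Fin n => V) σ).toLinearMap
  map_one' := by
    ext x
    exact PiTensorProduct.reindex_tprod (R := k) (s := fun _ => V) (1 : Equiv.Perm (Fin n)) x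
  map_mul' σ τ := by
    ext x
    have h : ∀ (ρ : Equiv.Perm (Fin n)) (y : Fin n → V),
        PiTensorProduct.reindex k (fun _ : Fin n => V) ρ (PiTensorProduct.tprod k y) =
          PiTensorProduct.tprod k fun i => y (ρ.symm i) :=
      fun ρ y => PiTensorProduct.reindex_tprod ρ y
    change PiTensorProduct.reindex k (fun _ : Fin n => V) (σ * τ) (PiTensorProduct.tprod k x) =
      PiTensorProduct.reindex k (fun _ : Fin n => V) σ
        (PiTensorProduct.reindex k (fun _ : Fin n => V) τ (PiTensorProduct.tprod k x))
    rw [h, h, h]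
    rfl

/-- `Span(X) ⊗ W` for a set `X` and a space `W`, realized as the space of finitely supported
functions from `X` to `W`, with `Finsupp.single x w` in the role of `x ⊗ w` (see
`TensorProduct.finsuppScalarLeft`). Here `W = V^{⊗ n}`. -/
abbrev SpanTensor : Type _ := X →₀ (⨂[k] _ : Fin n, V)

/-- The diagonal action of the symmetric group on `Span(X) ⊗ V^{⊗ n}`. -/
def diag (σ : Equiv.Perm (Fin n)) : SpanTensor k V n X →ₗ[k] SpanTensor k V n X :=
  Finsupp.lsum k fun x => Finsupp.lsingle (σ • x) ∘ₗ permTensor k V n σ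

@[simp] theorem diag_single (σ : Equiv.Perm (Fin n)) (x : X) (t : ⨂[k] _ : Fin n, V) :
    diag k V n X σ (Finsupp.single x t) = Finsupp.single (σ • x) (permTensor k V n σ t) := by
  simp [diag]

@[simp] theorem diag_one : diag k V n X 1 = LinearMap.id := by
  refine Finsupp.lhom_ext fun x t => ?_
  simp

/-- The span of the elements `σ z - z` with `σ ∈ Σₙ` and `z ∈ Span(X) ⊗ V^{⊗ n}`. -/
def diagKer : Submodule k (SpanTensor k V n X) :=
  Submodule.span k {d | ∃ (σ : Equiv.Perm (Fin n)) (z : SpanTensor k V n X),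
    d = diag k V n X σ z - z}

/-- `Span(X) ⊗_{Σₙ} V^{⊗ n}`, as the space of coinvariants of the diagonal action of `Σₙ` on
`Span(X) ⊗ V^{⊗ n}`. -/
def Decorated : Type _ := SpanTensor k V n X ⧸ diagKer k V n X

instance : AddCommGroup (Decorated k V n X) :=
  inferInstanceAs (AddCommGroup (SpanTensor k V n X ⧸ diagKer k V n X))

instance : Module k (Decorated k V n X) :=
  inferInstanceAs (Module k (SpanTensor k V n X ⧸ diagKer k V n X))

namespace Decorated

/-- The projection `Span(X) ⊗ V^{⊗ n} → Span(X) ⊗_{Σₙ} V^{⊗ n}`. -/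
def mk : SpanTensor k V n X →ₗ[k] Decorated k V n X := (diagKer k V n X).mkQ

theorem mk_surjective : Function.Surjective (mk k V n X) := (diagKer k V n X).mkQ_surjective

theorem mk_diag (σ : Equiv.Perm (Fin n)) (z : SpanTensor k V n X) :
    mk k V n X (diag k V n X σ z) = mk k V n X z :=
  (Submodule.Quotient.eq (diagKer k V n X)).2 (Submodule.subset_span ⟨σ, z, rfl⟩)

variable {k V n X}

/-- The linear map on `Span(X) ⊗_{Σₙ} V^{⊗ n}` induced by an invariant linear map. -/
def lift {U : Type*} [AddCommGroup U] [Module k U] (f : SpanTensor k V n X →ₗ[k] U)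
    (hf : ∀ σ z, f (diag k V n X σ z) = f z) : Decorated k V n X →ₗ[k] U :=
  (diagKer k V n X).liftQ f (by
    refine Submodule.span_le.2 ?_
    rintro _ ⟨σ, z, rfl⟩
    simp only [SetLike.mem_coe, LinearMap.mem_ker, map_sub, hf, sub_self])

@[simp] theorem lift_mk {U : Type*} [AddCommGroup U] [Module k U]
    (f : SpanTensor k V n X →ₗ[k] U) (hf : ∀ σ z, f (diag k V n X σ z) = f z) (z) :
    lift f hf (mk k V n X z) = f z := rfl

variable (k)

/-- The class of `x ⊗ v₁ ⊗ ⋯ ⊗ vₙ`. -/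
def of (x : X) (w : Fin n → V) : Decorated k V n X :=
  mk k V n X (Finsupp.single x (PiTensorProduct.tprod k w))

variable {W} (X)

/-- The linear map `Span(X) ⊗_{Σₙ} V^{⊗ n} → Span(X) ⊗_{Σₙ} W^{⊗ n}` induced by a linear map
`V → W`. -/
def map (f : V →ₗ[k] W) : Decorated k V n X →ₗ[k] Decorated k W n X :=
  lift (mk k W n X ∘ₗ Finsupp.mapRange.linearMap (PiTensorProduct.map fun _ : Fin n => f)) (by
    intro σ z
    have key : Finsupp.mapRange.linearMap (PiTensorProduct.map fun _ : Fin n => f)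
          (diag k V n X σ z) =
        diag k W n X σ
          (Finsupp.mapRange.linearMap (PiTensorProduct.map fun _ : Fin n => f) z) := by
      induction z using Finsupp.induction_linear with
      | zero => simp
      | add a b ha hb => simp only [map_add, ha, hb]
      | single x t =>
        have h : PiTensorProduct.map (fun _ : Fin n => f) (permTensor k V n σ t) =
            permTensor k W n σ (PiTensorProduct.map (fun _ : Fin n => f) t) :=
          PiTensorProduct.map_reindex (fun _ : Fin n => f) σ t
        simp only [diag_single, Finsupp.mapRange.linearMap_apply, Finsupp.mapRange_single, h]
    simp only [LinearMap.comp_apply, key, mk_diag])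

end Decorated

end Decorated

/-! ### The spaces `Tr(V)`, `Tr¹(V)` and the map `δ` -/

section Trees

variable (k : Type*) [CommRing k] (V W : Type*) [AddCommGroup V] [Module k V]
  [AddCommGroup W] [Module k W]

/-- The space `Tr(V) = ⨁ₙ Span(Trₙ) ⊗_{Σₙ} V^{⊗ n}` of rooted trees with vertices decorated by
elements of `V`. (There are no trees with `n = 0` vertices, so that the summand `n = 0`
vanishes.) -/
abbrev Tr : Type _ := ⨁ n : ℕ, Decorated k V n (RTree (Fin n))

/-- The space `Tr¹(V) = ⨁ₙ Span(Tr¹ₙ) ⊗_{Σₙ} V^{⊗ n}` of rooted trees with one special vertex, all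
other vertices being decorated by elements of `V`. -/
abbrev Tr1 : Type _ := ⨁ n : ℕ, Decorated k V n (RTree (Option (Fin n)))

variable {V} in
/-- The rooted tree `T` with vertices decorated by `w`. -/
def Tr.of {n : ℕ} (T : RTree (Fin n)) (w : Fin n → V) : Tr k V :=
  DirectSum.lof k ℕ (fun n => Decorated k V n (RTree (Fin n))) n (Decorated.of k T w)

variable {V} in
/-- The one-vertex tree decorated by `x`. -/
def Tr.vertex (x : V) : Tr k V := Tr.of k (RTree.single (Fin 1)) (fun _ => x)

variable {V W} in
/-- The functoriality of `Tr(V)` in `V`. -/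
def Tr.map (f : V →ₗ[k] W) : Tr k V →ₗ[k] Tr k W :=
  DirectSum.lmap fun n => Decorated.map k (RTree (Fin n)) f

open Classical in
/-- The map `T ⊗ t ↦ ∑ ε_{(S,e)} S ⊗ t`, the sum being over all blow-ups `(S, e)` of `T`. -/
def deltaTensor (n : ℕ) :
    SpanTensor k V n (RTree (Fin n)) →ₗ[k] SpanTensor k V n (RTree (Option (Fin n))) :=
  Finsupp.lsum k fun T => ∑ p : RTree (Option (Fin n)) × Fin n with p ∈ T.blowUps,
    RTree.sign p • Finsupp.lsingle p.1

open Classical in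
theorem deltaTensor_single {n : ℕ} (T : RTree (Fin n)) (t) :
    deltaTensor k V n (Finsupp.single T t) =
      ∑ p : RTree (Option (Fin n)) × Fin n with p ∈ T.blowUps,
        RTree.sign p • Finsupp.single p.1 t := by
  rw [deltaTensor, Finsupp.lsum_single, LinearMap.sum_apply]
  rfl

theorem deltaTensor_diag {n : ℕ} (σ : Equiv.Perm (Fin n)) (z) :
    deltaTensor k V n (diag k V n _ σ z) = diag k V n _ σ (deltaTensor k V n z) := by
  classical
  induction z using Finsupp.induction_linear with
  | zero => rw [map_zero, map_zero, map_zero]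
  | add a b ha hb => rw [map_add, map_add, map_add, map_add, ha, hb]
  | single T t =>
    rw [diag_single, deltaTensor_single, deltaTensor_single, map_sum]
    symm
    refine Finset.sum_equiv
      ((RTree.relabelEquiv (Equiv.optionCongr σ)).prodCongr σ) ?_ ?_
    · rintro ⟨S, x⟩
      rw [Finset.mem_filter_univ, Finset.mem_filter_univ]
      exact (RTree.mem_blowUps_relabel σ S x T).symm
    · rintro ⟨S, x⟩ -
      rw [map_zsmul, diag_single]
      exact congrArg (fun z : ℤ => z • Finsupp.single (σ • S) (permTensor k V n σ t))
        (RTree.sign_relabel σ S x).symm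

/-- The map `δ : Tr(V) → Tr¹(V)`, which sends a decorated tree to the signed sum of its
blow-ups. -/
def delta : Tr k V →ₗ[k] Tr1 k V :=
  DirectSum.lmap fun n =>
    Decorated.lift (Decorated.mk k V n (RTree (Option (Fin n))) ∘ₗ deltaTensor k V n) (by
      intro σ z
      simp only [LinearMap.comp_apply, deltaTensor_diag, Decorated.mk_diag])

/-! ### The pre-Lie product of decorated trees -/

/-- Juxtaposition of permutations. -/
def juxt {m n : ℕ} (σ : Equiv.Perm (Fin m)) (τ : Equiv.Perm (Fin n)) : Equiv.Perm (Fin (m + n)) :=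
  (finSumFinEquiv.symm.trans (Equiv.sumCongr σ τ)).trans finSumFinEquiv

/-- The concatenation of tensors `V^{⊗ m} × V^{⊗ n} → V^{⊗ (m + n)}`. -/
def concat (m n : ℕ) :
    (⨂[k] _ : Fin m, V) →ₗ[k] (⨂[k] _ : Fin n, V) →ₗ[k] ⨂[k] _ : Fin (m + n), V :=
  TensorProduct.curry
    ((PiTensorProduct.reindex k (fun _ : Fin m ⊕ Fin n => V) finSumFinEquiv).toLinearMap ∘ₗ
      (PiTensorProduct.tmulEquiv k V).toLinearMap)

theorem concat_tprod {m n : ℕ} (x : Fin m → V) (y : Fin n → V) :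
    concat k V m n (PiTensorProduct.tprod k x) (PiTensorProduct.tprod k y) =
      PiTensorProduct.tprod k fun i => Sum.elim x y (finSumFinEquiv.symm i) := by
  simp only [concat, TensorProduct.curry_apply, LinearMap.comp_apply, LinearEquiv.coe_coe,
    PiTensorProduct.tmulEquiv_apply]
  exact PiTensorProduct.reindex_tprod (s := fun _ : Fin m ⊕ Fin n => V) finSumFinEquiv (Sum.elim x y)

theorem permTensor_tprod {n : ℕ} (σ : Equiv.Perm (Fin n)) (x : Fin n → V) :
    permTensor k V n σ (PiTensorProduct.tprod k x) =
      PiTensorProduct.tprod k fun i => x (σ.symm i) :=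
  PiTensorProduct.reindex_tprod (s := fun _ : Fin n => V) σ x

theorem concat_perm {m n : ℕ} (σ : Equiv.Perm (Fin m)) (τ : Equiv.Perm (Fin n)) (s t) :
    concat k V m n (permTensor k V m σ s) (permTensor k V n τ t) =
      permTensor k V (m + n) (juxt σ τ) (concat k V m n s t) := by
  induction s using PiTensorProduct.induction_on with
  | add a b ha hb => simp only [map_add, LinearMap.add_apply, ha, hb]
  | smul_tprod r x =>
  induction t using PiTensorProduct.induction_on with
  | add a b ha hb => simp only [map_add, ha, hb]
  | smul_tprod c y =>
    simp only [map_smul, LinearMap.smul_apply, permTensor_tprod, concat_tprod]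
    congr 3
    funext i
    obtain ⟨z, rfl⟩ := finSumFinEquiv.surjective i
    rcases z with z | z <;> simp [juxt]

/-- The bilinear map `(T ⊗ s, S ⊗ t) ↦ ∑ R ⊗ st`, where `R` runs over the trees obtained by grafting
`S` onto the vertices `a` of `T`. -/
def starTensor (m n : ℕ) :
    SpanTensor k V m (RTree (Fin m)) →ₗ[k] SpanTensor k V n (RTree (Fin n)) →ₗ[k]
      SpanTensor k V (m + n) (RTree (Fin (m + n))) :=
  Finsupp.lsum k fun T => LinearMap.flip <| Finsupp.lsum k fun S => LinearMap.flip <|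
    ∑ a : Fin m, (concat k V m n).compr₂ (Finsupp.lsingle ((T.graft a S).relabel finSumFinEquiv))

theorem starTensor_single {m n : ℕ} (T : RTree (Fin m)) (S : RTree (Fin n)) (s t) :
    starTensor k V m n (Finsupp.single T s) (Finsupp.single S t) =
      ∑ a : Fin m, Finsupp.single ((T.graft a S).relabel finSumFinEquiv) (concat k V m n s t) := by
  simp [starTensor, LinearMap.sum_apply]

theorem starTensor_diag {m n : ℕ} (σ : Equiv.Perm (Fin m)) (τ : Equiv.Perm (Fin n)) (a b) :
    starTensor k V m n (diag k V m _ σ a) (diag k V n _ τ b) =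
      diag k V (m + n) _ (juxt σ τ) (starTensor k V m n a b) := by
  induction a using Finsupp.induction_linear with
  | zero => simp
  | add a a' h h' => simp only [map_add, LinearMap.add_apply, h, h']
  | single T s =>
  induction b using Finsupp.induction_linear with
  | zero => simp
  | add b b' h h' => simp only [map_add, h, h']
  | single S t =>
    simp only [diag_single, starTensor_single, map_sum, concat_perm]
    symm
    refine Fintype.sum_equiv σ _ _ fun a => ?_
    congr 1
    simp only [RTree.smul_def, RTree.graft_relabel, RTree.relabel_relabel]
    congr 1
    ext z
    simp [juxt]

/-- The grafting product on decorated trees with `m` and `n` vertices. -/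
def starHom (m n : ℕ) :
    Decorated k V m (RTree (Fin m)) →ₗ[k] Decorated k V n (RTree (Fin n)) →ₗ[k]
      Decorated k V (m + n) (RTree (Fin (m + n))) :=
  Decorated.lift
    (LinearMap.flip (Decorated.lift
      (LinearMap.flip ((starTensor k V m n).compr₂
        (Decorated.mk k V (m + n) (RTree (Fin (m + n)))))) (by
        intro τ b
        refine LinearMap.ext fun a => ?_
        have h := starTensor_diag k V (1 : Equiv.Perm (Fin m)) τ a b
        rw [diag_one, LinearMap.id_apply] at h
        simp only [LinearMap.flip_apply, LinearMap.compr₂_apply]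
        rw [h, Decorated.mk_diag]))) (by
    intro σ a
    refine LinearMap.ext fun z => ?_
    obtain ⟨b, rfl⟩ := Decorated.mk_surjective k V n (RTree (Fin n)) z
    have h := starTensor_diag k V σ (1 : Equiv.Perm (Fin n)) a b
    rw [diag_one, LinearMap.id_apply] at h
    simp only [LinearMap.flip_apply, Decorated.lift_mk, LinearMap.compr₂_apply]
    rw [h, Decorated.mk_diag])

/-- The pre-Lie product `T ⋆ S` of decorated trees: the sum over the vertices of `T` of the
decorated trees obtained by connecting the root of `S` by a new edge with this vertex. -/
def star : Tr k V →ₗ[k] Tr k V →ₗ[k] Tr k V :=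
  DirectSum.toModule k ℕ _ fun m => LinearMap.flip (DirectSum.toModule k ℕ _ fun n =>
    LinearMap.flip ((starHom k V m n).compr₂
      (DirectSum.lof k ℕ (fun n => Decorated k V n (RTree (Fin n))) (m + n))))

end Trees

/-! ### The free Lie algebra on a vector space -/

section FreeLie

variable (k : Type*) [CommRing k] (V W : Type*) [AddCommGroup V] [Module k V]
  [AddCommGroup W] [Module k W]

/-- The relations, in the free Lie algebra on the underlying set of `V`, which express that the
canonical map from `V` is linear. -/
def linearityRelations : Set (FreeLieAlgebra k V) :=
  {z | (∃ x y : V, z = FreeLieAlgebra.of k (x + y) - FreeLieAlgebra.of k x - FreeLieAlgebra.of k y) ∨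
    ∃ (c : k) (x : V), z = FreeLieAlgebra.of k (c • x) - c • FreeLieAlgebra.of k x}

/-- The Lie ideal generated by the linearity relations. -/
def linearityIdeal : LieIdeal k (FreeLieAlgebra k V) :=
  LieSubmodule.lieSpan k (FreeLieAlgebra k V) (linearityRelations k V)

/-- The free Lie algebra `L(V)` on the vector space `V`: it has the universal property that every
linear map from `V` to a Lie algebra extends uniquely to a homomorphism of Lie algebras. -/
abbrev FreeLie : Type _ := FreeLieAlgebra k V ⧸ linearityIdeal k V

variable {V W}

namespace FreeLie

/-- The canonical linear map from `V` to the free Lie algebra on `V`. -/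
def of : V →ₗ[k] FreeLie k V where
  toFun x := LieSubmodule.Quotient.mk (FreeLieAlgebra.of k x)
  map_add' x y := by
    rw [← Submodule.Quotient.mk_add, Submodule.Quotient.eq]
    refine LieSubmodule.subset_lieSpan (Or.inl ⟨x, y, ?_⟩)
    abel
  map_smul' c x := by
    rw [RingHom.id_apply, ← Submodule.Quotient.mk_smul, Submodule.Quotient.eq]
    exact LieSubmodule.subset_lieSpan (Or.inr ⟨c, x, rfl⟩)

variable {L : Type*} [LieRing L] [LieAlgebra k L]

/-- The homomorphism from the free Lie algebra which extends a given linear map. -/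
def lift (f : V →ₗ[k] L) : FreeLie k V →ₗ⁅k⁆ L where
  toLinearMap := Submodule.liftQ _ (FreeLieAlgebra.lift k f : FreeLieAlgebra k V →ₗ[k] L) (by
    have h : linearityIdeal k V ≤ (FreeLieAlgebra.lift k (f : V → L)).ker := by
      refine LieSubmodule.lieSpan_le.2 ?_
      rintro z (⟨x, y, rfl⟩ | ⟨c, x, rfl⟩) <;> simp [LieHom.mem_ker]
    intro z hz
    exact LieHom.mem_ker.1 (h hz))
  map_lie' {x y} := by
    induction x using Submodule.Quotient.induction_on
    induction y using Submodule.Quotient.induction_on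
    exact LieHom.map_lie (FreeLieAlgebra.lift k (f : V → L)) _ _

@[simp] theorem lift_of (f : V →ₗ[k] L) (x : V) : lift k f (of k x) = f x :=
  FreeLieAlgebra.lift_of_apply (f : V → L) x

theorem hom_ext {F G : FreeLie k V →ₗ⁅k⁆ L} (h : ∀ x, F (of k x) = G (of k x)) : F = G := by
  let π : FreeLieAlgebra k V →ₗ⁅k⁆ FreeLie k V :=
    { (linearityIdeal k V).toSubmodule.mkQ with map_lie' := fun {_ _} => rfl }
  have key : F.comp π = G.comp π := FreeLieAlgebra.hom_ext h
  ext z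
  induction z using Submodule.Quotient.induction_on with
  | _ z => exact LieHom.congr_fun key z

/-- The functoriality of `L(V)` in `V`. -/
def map (f : V →ₗ[k] W) : FreeLie k V →ₗ⁅k⁆ FreeLie k W := lift k (of k ∘ₗ f)

end FreeLie

end FreeLie

end LieTrees

end

noncomputable section

namespace LieTrees

/-! ### Depth, ranks and adjacency in a rooted tree. -/

namespace RTree

variable {α β : Type*}

/-! Grafting `star` is a pre-Lie product, so its commutator makes `Tr k V` a Lie algebra, and `v ↦
Tr.vertex k v` extends to a Lie homomorphism `toTrees`. Compatibility with brackets and naturality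
are then formal. What remains is that `toTrees` is injective with image the kernel of `delta`.

Image in the kernel. Left normed brackets span the image. Expanded in trees on their ordered
entries, such a bracket has coefficients `bracketCoeff`: zero unless each vertex has at most one
neighbour of smaller rank, and otherwise a factor `-1` for each edge directed towards a larger rank
(`lie_bracketSum`). The coefficient of `S` in the image of `f` under δ is the signed sum of `f
(S/e)` over the special edges `e`. For `f = bracketCoeff ρ` only the edges to the two smallest
neighbours of the special vertex can contribute, and these contributions cancel
(`isBalanced_bracketCoeff`).

Kernel in the image. Fix a vertex `z`. The balance conditions express a function by its values on
ladders with root `z`: siblings can be pushed on top of each other, and moving the root to a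
neighbour changes the sign (`IsBalanced.eq_zero`). The functions `bracketCoeff L.depth`, for these
ladders `L`, take the value 1 on `L` and 0 on the other ones, so every balanced function is a
combination of brackets (`eq_sum_smulTensor`). Symmetrization transfers this to coinvariants, at the
cost of dividing by `n!`.

Injectivity. Reading a ladder as a left normed bracket and killing all other trees defines
`ofTrees`. The composite `ofTrees ∘ toTrees` is a derivation fixing `V`, so it multiplies degree `n`
by `n`, which is injective in characteristic zero. -/

theorem parent_iterate_root (T : RTree α) (m : ℕ) : T.parent^[m] T.root = T.root :=
  Function.iterate_fixed T.parent_root m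

open Classical in
/-- The distance of a vertex from the root. -/
def depth (T : RTree α) (a : α) : ℕ := Nat.find (T.reaches_root a)

theorem parent_iterate_depth (T : RTree α) (a : α) : T.parent^[T.depth a] a = T.root := by
  classical exact Nat.find_spec (T.reaches_root a)

theorem depth_le (T : RTree α) {a : α} {m : ℕ} (h : T.parent^[m] a = T.root) : T.depth a ≤ m := by
  classical exact Nat.find_min' (T.reaches_root a) h

@[simp] theorem depth_root (T : RTree α) : T.depth T.root = 0 :=
  Nat.le_zero.1 (T.depth_le (m := 0) rfl)

theorem depth_eq_zero (T : RTree α) {a : α} : T.depth a = 0 ↔ a = T.root := by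
  constructor
  · intro h
    have := T.parent_iterate_depth a
    rwa [h] at this
  · rintro rfl
    simp

theorem depth_parent (T : RTree α) {a : α} (h : a ≠ T.root) :
    T.depth a = T.depth (T.parent a) + 1 := by
  apply le_antisymm
  · apply T.depth_le
    rw [Function.iterate_succ_apply]
    exact T.parent_iterate_depth _
  · have h0 : T.depth a ≠ 0 := fun h' => h (T.depth_eq_zero.1 h')
    obtain ⟨d, hd⟩ := Nat.exists_eq_succ_of_ne_zero h0
    have := T.parent_iterate_depth a
    rw [hd, Nat.succ_eq_add_one, Function.iterate_succ_apply] at this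
    have := T.depth_le this
    omega

theorem parent_ne (T : RTree α) {a : α} (h : a ≠ T.root) : T.parent a ≠ a := by
  intro h'
  have := T.depth_parent h
  rw [h'] at this
  omega

theorem parent_eq_self (T : RTree α) {a : α} : T.parent a = a ↔ a = T.root :=
  ⟨fun h => by_contra fun h' => T.parent_ne h' h, by rintro rfl; exact T.parent_root⟩

theorem edge_iff (T : RTree α) {a b : α} : T.Edge a b ↔ a ≠ T.root ∧ T.parent a = b := by
  constructor
  · rintro ⟨h, rfl⟩
    exact ⟨fun h' => h (T.parent_eq_self.2 h').symm, rfl⟩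
  · rintro ⟨h, rfl⟩
    exact ⟨(T.parent_ne h).symm, rfl⟩

theorem depth_of_edge (T : RTree α) {a b : α} (h : T.Edge a b) : T.depth a = T.depth b + 1 := by
  obtain ⟨h1, rfl⟩ := T.edge_iff.1 h
  exact T.depth_parent h1

theorem exists_depth_eq (T : RTree α) (a : α) {j : ℕ} (hj : j ≤ T.depth a) :
    ∃ b, T.depth b = j := by
  induction h : T.depth a generalizing a with
  | zero => exact ⟨a, by omega⟩
  | succ d ih =>
    rcases Nat.lt_or_ge d j with h' | h'
    · exact ⟨a, by omega⟩
    · have ha : a ≠ T.root := by rintro rfl; simp at h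
      have := T.depth_parent ha
      exact ih (T.parent a) (by omega) (by omega)

/-- A tree is determined by its parent function. -/
theorem ext_of_parent {S T : RTree α} (h : S.parent = T.parent) : S = T := by
  refine RTree.ext ?_ h
  rw [← T.parent_eq_self, ← h, S.parent_root]

/-- The tree given by a parent function which decreases some rank. -/
@[simps]
def ofRank (root : α) (parent : α → α) (h : parent root = root) (rank : α → ℕ)
    (hr : ∀ x, x ≠ root → rank (parent x) < rank x) : RTree α where
  root := root
  parent := parent
  parent_root := h
  reaches_root x := by
    induction hn : rank x using Nat.strong_induction_on generalizing x with
    | _ n ih =>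
      by_cases hx : x = root
      · exact ⟨0, hx⟩
      · obtain ⟨m, hm⟩ := ih _ (hn ▸ hr x hx) (parent x) rfl
        exact ⟨m + 1, by rwa [Function.iterate_succ_apply]⟩

/-- Two vertices are adjacent if there is an edge between them, in any direction. -/
def Adj (T : RTree α) (a b : α) : Prop := T.Edge a b ∨ T.Edge b a

theorem Adj.symm {T : RTree α} {a b : α} (h : T.Adj a b) : T.Adj b a := Or.symm h

theorem Adj.ne {T : RTree α} {a b : α} (h : T.Adj a b) : a ≠ b :=
  h.elim (fun h => h.1) (fun h => h.1.symm)

theorem Adj.depth {T : RTree α} {a b : α} (h : T.Adj a b) :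
    T.depth a = T.depth b + 1 ∨ T.depth b = T.depth a + 1 :=
  h.imp T.depth_of_edge T.depth_of_edge

/-- Trees have no triangles. -/
theorem Adj.not_adj {T : RTree α} {a b c : α} (h : T.Adj a b) (h' : T.Adj a c) : ¬ T.Adj b c := by
  intro h''
  have h1 := h.depth
  have h2 := h'.depth
  have h3 := h''.depth
  -- Adjacent depths differ by one, hence have opposite parity, which is impossible for three
  -- pairwise adjacent vertices.
  omega

/-! ### Contractions -/

theorem isSpecialEdge_iff {S : RTree (Option α)} {x : α} :
    IsSpecialEdge S x ↔ S.parent (some x) = none ∨ S.parent none = some x := by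
  simp [IsSpecialEdge, Edge]

open Classical in
/-- The parent function of the contraction of a special edge. -/
def contractParent (S : RTree (Option α)) (x y : α) : α :=
  -- If the contracted edge leaves `x`, the merged vertex continues along the outgoing edge of the
  -- special vertex; otherwise it keeps the outgoing edge of `x`.
  if y = x ∧ S.parent (some x) = none then collapse x (S.parent none)
  else collapse x (S.parent (some y))

@[simp] theorem collapse_none (x : α) : collapse x none = x := rfl

@[simp] theorem collapse_some (x y : α) : collapse x (some y) = y := rfl

theorem contractParent_self {S : RTree (Option α)} {x : α} (h : S.parent (some x) = none) :
    contractParent S x x = collapse x (S.parent none) := if_pos ⟨rfl, h⟩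

theorem contractParent_of_not {S : RTree (Option α)} {x y : α}
    (h : ¬(y = x ∧ S.parent (some x) = none)) :
    contractParent S x y = collapse x (S.parent (some y)) := if_neg h

/-- A step towards the root either survives the contraction or is the contracted edge itself and
becomes stationary. Thus paths and edges of `S` project to the contraction. -/
theorem collapse_parent (S : RTree (Option α)) {x : α} (hx : IsSpecialEdge S x) (o : Option α) :
    collapse x (S.parent o) = contractParent S x (collapse x o) ∨
      collapse x (S.parent o) = collapse x o := by
  rw [isSpecialEdge_iff] at hx
  cases o with
  | none =>
    rcases hx with hx | hx
    · exact Or.inl (contractParent_self hx).symm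
    · exact Or.inr (by rw [hx]; rfl)
  | some y =>
    by_cases hy : y = x ∧ S.parent (some x) = none
    · obtain ⟨rfl, h⟩ := hy
      exact Or.inr (by rw [h]; rfl)
    · exact Or.inl (contractParent_of_not hy).symm

/-- The tree `S/e` for a special edge `e`. -/
@[simps]
def contract (S : RTree (Option α)) (x : {x // IsSpecialEdge S x}) : RTree α where
  root := collapse x.1 S.root
  parent := contractParent S x.1
  parent_root := by
    obtain ⟨x, hx⟩ := x
    rw [isSpecialEdge_iff] at hx
    have hr := S.parent_root
    rcases hS : S.root with _ | y
    · rw [hS] at hr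
      rw [hr] at hx
      have hx : S.parent (some x) = none := by simpa using hx
      rw [collapse_none, contractParent_self hx, hr, collapse_none]
    · rw [hS] at hr
      rw [collapse_some, contractParent_of_not, hr, collapse_some]
      rintro ⟨h1, h⟩
      simp only at h1 h
      subst h1
      rw [hr] at h
      cases h
  reaches_root := by
    obtain ⟨x, hx⟩ := x
    have key : ∀ (m : ℕ) (o : Option α), S.parent^[m] o = S.root →
        ∃ j : ℕ, (contractParent S x)^[j] (collapse x o) = collapse x S.root := by
      intro m
      induction m with
      | zero => intro o ho; exact ⟨0, congrArg (collapse x) ho⟩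
      | succ m ih =>
        intro o ho
        rw [Function.iterate_succ_apply] at ho
        obtain ⟨j, hj⟩ := ih _ ho
        rcases collapse_parent S hx o with h | h
        · exact ⟨j + 1, by rw [Function.iterate_succ_apply, ← h, hj]⟩
        · exact ⟨j, by rw [← h, hj]⟩
    intro y
    obtain ⟨m, hm⟩ := S.reaches_root (some y)
    exact key m _ hm

theorem edge_contract (S : RTree (Option α)) (x : {x // IsSpecialEdge S x}) (a b : α) :
    (S.contract x).Edge a b ↔
      a ≠ b ∧ ∃ a' b', S.Edge a' b' ∧ collapse x.1 a' = a ∧ collapse x.1 b' = b := by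
  obtain ⟨x, hx⟩ := x
  constructor
  · rintro ⟨hab, h⟩
    refine ⟨hab, ?_⟩
    simp only [contract_parent, contractParent] at h
    split_ifs at h with hc
    · obtain ⟨rfl, hp⟩ := hc
      refine ⟨none, S.parent none, ⟨fun h' => hab ?_, rfl⟩, rfl, h⟩
      rw [← h, ← h']
      rfl
    · refine ⟨some a, S.parent (some a), ⟨fun h' => hab ?_, rfl⟩, rfl, h⟩
      rw [← h, ← h']
      rfl
  · rintro ⟨hab, a', b', ⟨-, rfl⟩, rfl, rfl⟩
    refine ⟨hab, ?_⟩
    rcases collapse_parent S hx a' with h | h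
    · exact h.symm
    · exact absurd h.symm hab

/-- A tree is determined by its root and its edges. -/
theorem ext_of_edge {S T : RTree α} (h : ∀ a b, S.Edge a b ↔ T.Edge a b) : S = T := by
  refine ext_of_parent (funext fun a => ?_)
  by_cases hS : S.parent a = a
  · by_contra hne
    have : T.Edge a (T.parent a) := ⟨fun h' => hne (hS.trans h'), rfl⟩
    exact hne ((h _ _).2 this).2
  · exact (((h _ _).1 ⟨Ne.symm hS, rfl⟩).2).symm

/-- Edges alone determine a tree, so each special edge of `S` has exactly one contraction. This
turns sums over blow-ups into sums over special edges. -/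
theorem isContraction_iff (S : RTree (Option α)) (x : {x // IsSpecialEdge S x}) (T : RTree α) :
    IsContraction S x.1 T ↔ T = S.contract x := by
  constructor
  · rintro ⟨-, h⟩
    refine ext_of_edge fun a b => ?_
    rw [h, edge_contract]
  · rintro rfl
    exact ⟨rfl, edge_contract S x⟩

/-- Forgetting orientations, the merged vertex inherits all neighbours of the special vertex; this
form suits `IsIncreasing`, which ignores orientations. -/
theorem adj_contract (S : RTree (Option α)) (x : {x // IsSpecialEdge S x}) (a b : α) :
    (S.contract x).Adj a b ↔ a ≠ b ∧ (S.Adj (some a) (some b) ∨ (a = x.1 ∧ IsSpecialEdge S b) ∨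
      (b = x.1 ∧ IsSpecialEdge S a)) := by
  obtain ⟨x, hx⟩ := x
  have key : ∀ a b : α, (∃ a' b', S.Edge a' b' ∧ collapse x a' = a ∧ collapse x b' = b) ↔
      S.Edge (some a) (some b) ∨ (a = x ∧ S.Edge none (some b)) ∨
        (b = x ∧ S.Edge (some a) none) := by
    intro a b
    constructor
    · rintro ⟨_ | a', _ | b', h, rfl, rfl⟩
      · exact absurd rfl h.1
      · exact Or.inr (Or.inl ⟨rfl, h⟩)
      · exact Or.inr (Or.inr ⟨rfl, h⟩)
      · exact Or.inl h
    · rintro (h | ⟨rfl, h⟩ | ⟨rfl, h⟩)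
      · exact ⟨_, _, h, rfl, rfl⟩
      · exact ⟨_, _, h, rfl, rfl⟩
      · exact ⟨_, _, h, rfl, rfl⟩
  have h1 := edge_contract S ⟨x, hx⟩ a b
  have h2 := edge_contract S ⟨x, hx⟩ b a
  rw [key] at h1 h2
  simp only [Adj, IsSpecialEdge]
  have : a ≠ b ↔ b ≠ a := ne_comm
  tauto

theorem parent_contract_of_ne (S : RTree (Option α)) (x : {x // IsSpecialEdge S x}) {y : α}
    (hy : y ≠ x.1) : (S.contract x).parent y = collapse x.1 (S.parent (some y)) := by
  rw [contract_parent, contractParent_of_not fun h => hy h.1]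

/-! ### Balanced functions -/

/-- The sign of a special edge is `1` if this edge goes to the special vertex, and `-1` otherwise. -/
theorem sign_of_parent (S : RTree (Option α)) {x : α} (h : S.parent (some x) = none) :
    sign (S, x) = 1 := by
  simp [sign, Edge, h]

theorem sign_of_parent_none (S : RTree (Option α)) {x : α} (h : S.parent none = some x) :
    sign (S, x) = -1 := by
  have h1 := S.depth_of_edge (a := none) (b := some x) ⟨by simp, h⟩
  rw [sign, if_neg]
  intro h'
  have := S.depth_of_edge h'
  simp only at this
  omega

theorem two_le_arity [Finite α] (T : RTree α) {b x y : α} (hxy : x ≠ y) (hx : T.Edge x b)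
    (hy : T.Edge y b) : 2 ≤ T.arity b := by
  have : 1 < Set.ncard {a | T.Edge a b} :=
    (Set.one_lt_ncard_iff (Set.toFinite _)).2 ⟨x, y, hx, hy, hxy⟩
  exact this

theorem exists_of_two_le_arity (T : RTree α) {b : α} (h : 2 ≤ T.arity b) :
    ∃ x y, x ≠ y ∧ T.Edge x b ∧ T.Edge y b := by
  have h1 : 1 < Set.ncard {a | T.Edge a b} := h
  obtain ⟨x, hx, y, hy, hxy⟩ :=
    (Set.one_lt_ncard (Set.finite_of_ncard_pos (by omega))).1 h1
  exact ⟨x, y, hxy, hx, hy⟩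

open Classical in
/-- A function on trees is balanced if it is annihilated by `δ`. -/
def IsBalanced [Fintype α] {M : Type*} [AddCommGroup M] (f : RTree α → M) : Prop :=
  ∀ S : RTree (Option α), 2 ≤ S.arity none →
    ∑ x : {x // IsSpecialEdge S x}, sign (S, x.1) • f (S.contract x) = 0

/-! ### Balanced functions are determined by their values on ladders -/

/-- A ladder is a tree all of whose vertices have arity at most one. -/
def IsLadder (T : RTree α) : Prop :=
  ∀ a b, a ≠ T.root → b ≠ T.root → T.parent a = T.parent b → a = b

open Classical in
/-- The tree obtained by inserting the special vertex between `p` and all the children of `p`. -/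
def insertAbove (T : RTree α) (p : α) : RTree (Option α) :=
  ofRank (some T.root)
    (fun o => o.elim (some p)
      fun y => if T.parent y = p ∧ y ≠ T.root then none else some (T.parent y))
    (by simp [T.parent_root])
    -- Doubling the depths leaves an odd rank free between `p` and its children.
    (fun o => o.elim (2 * T.depth p + 1) fun y => 2 * T.depth y)
    (by
      rintro (_ | y) hy
      · simp
      · have hy : y ≠ T.root := fun h => hy (congrArg some h)
        have := T.depth_parent hy
        by_cases h : T.parent y = p
        · simp [h, hy]
          rw [h] at this
          omega
        · simp [h]
          omega)

@[simp] theorem insertAbove_parent_none (T : RTree α) (p : α) :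
    (T.insertAbove p).parent none = some p := rfl

theorem insertAbove_parent_some (T : RTree α) {p y : α} (h : T.parent y = p) (hy : y ≠ T.root) :
    (T.insertAbove p).parent (some y) = none := if_pos ⟨h, hy⟩

theorem insertAbove_parent_some_of_not (T : RTree α) {p y : α}
    (h : ¬(T.parent y = p ∧ y ≠ T.root)) :
    (T.insertAbove p).parent (some y) = some (T.parent y) := if_neg h

theorem contract_insertAbove (T : RTree α) (p : α) (h : IsSpecialEdge (T.insertAbove p) p) :
    (T.insertAbove p).contract ⟨p, h⟩ = T := by
  have hp : (T.insertAbove p).parent (some p) ≠ none := by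
    rw [insertAbove_parent_some_of_not]
    · simp
    · rintro ⟨h1, h2⟩
      exact T.parent_ne h2 h1
  refine ext_of_parent (funext fun y => ?_)
  rw [contract_parent, contractParent_of_not fun h => hp h.2]
  by_cases hy : T.parent y = p ∧ y ≠ T.root
  · rw [insertAbove_parent_some _ hy.1 hy.2, collapse_none, hy.1]
  · rw [insertAbove_parent_some_of_not _ hy, collapse_some]

theorem isSpecialEdge_insertAbove {T : RTree α} {p x : α} (hx : IsSpecialEdge (T.insertAbove p) x)
    (hxp : x ≠ p) : T.parent x = p ∧ x ≠ T.root := by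
  rw [isSpecialEdge_iff, insertAbove_parent_none] at hx
  by_contra h
  rw [insertAbove_parent_some_of_not _ h] at hx
  rcases hx with hx | hx
  · cases hx
  · exact hxp (Option.some.inj hx).symm

/-- Contracting the edge from a child `x` of `p` keeps `x` below `p` and reattaches all siblings of
`x` to `x`. Hence no depth drops and the siblings of `x` become strictly deeper, which makes the
total depth a measure of progress towards ladders. -/
theorem depth_le_insertAbove (T : RTree α) (p : α)
    (x : {x // IsSpecialEdge (T.insertAbove p) x}) (hxp : x.1 ≠ p) (y : α) :
    T.depth y ≤ ((T.insertAbove p).contract x).depth y ∧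
      (T.parent y = p → y ≠ T.root → y ≠ x.1 →
        T.depth y < ((T.insertAbove p).contract x).depth y) := by
  obtain ⟨x, hx⟩ := x
  simp only at hxp
  obtain ⟨h1, h2⟩ := isSpecialEdge_insertAbove hx hxp
  set T' := (T.insertAbove p).contract ⟨x, hx⟩ with hT'
  have hroot : T'.root = T.root := rfl
  have hpx : T'.parent x = p := by
    rw [hT', contract_parent, contractParent_self (insertAbove_parent_some _ h1 h2)]
    rfl
  induction hd : T'.depth y using Nat.strong_induction_on generalizing y with
  | _ d ih =>
    by_cases hy : y = T.root
    · subst hy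
      simp
    · have hy' : y ≠ T'.root := hy
      have e1 := T.depth_parent hy
      have e2 := T'.depth_parent hy'
      by_cases hyx : y = x
      · subst hyx
        rw [hpx] at e2
        rw [h1] at e1
        have := (ih _ (by omega) p rfl).1
        exact ⟨by omega, fun _ _ h => absurd rfl h⟩
      · by_cases hyp : T.parent y = p
        · have h3 : T'.parent y = x := by
            rw [hT', parent_contract_of_ne _ _ hyx, insertAbove_parent_some _ hyp hy]
            rfl
          rw [h3] at e2
          have e3 := T'.depth_parent (a := x) h2
          rw [hpx] at e3
          rw [hyp] at e1
          have := (ih _ (by omega) p rfl).1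
          exact ⟨by omega, fun _ _ _ => by omega⟩
        · have h3 : T'.parent y = T.parent y := by
            rw [hT', parent_contract_of_ne _ _ hyx,
              insertAbove_parent_some_of_not _ (fun h => hyp h.1)]
            rfl
          rw [h3] at e2
          have := (ih _ (by omega) (T.parent y) rfl).1
          exact ⟨by omega, fun h => absurd h hyp⟩

/-- In the balance condition at `T.insertAbove p`, the outgoing edge of the special vertex
contributes `-f T` and every other term vanishes by assumption. The two siblings provide the
required arity. -/
theorem IsBalanced.eq_zero_of_insertAbove [Fintype α] {M : Type*} [AddCommGroup M]
    {f : RTree α → M} (hf : IsBalanced f) (T : RTree α) {a b : α} (hab : a ≠ b)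
    (ha : a ≠ T.root) (hb : b ≠ T.root) (h : T.parent a = T.parent b)
    (h0 : ∀ x : {x // IsSpecialEdge (T.insertAbove (T.parent a)) x}, x.1 ≠ T.parent a →
      f ((T.insertAbove (T.parent a)).contract x) = 0) : f T = 0 := by
  classical
  set p := T.parent a with hp
  have hsp : IsSpecialEdge (T.insertAbove p) p := isSpecialEdge_iff.2 (Or.inr rfl)
  have har : 2 ≤ (T.insertAbove p).arity none :=
    two_le_arity _ (x := some a) (y := some b) (fun h => hab (Option.some.inj h))
      ⟨by simp, insertAbove_parent_some _ rfl ha⟩ ⟨by simp, insertAbove_parent_some _ h.symm hb⟩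
  have key := hf _ har
  rw [Fintype.sum_eq_single ⟨p, hsp⟩, contract_insertAbove, sign_of_parent_none _ rfl] at key
  · simpa using key
  · intro x hx
    rw [h0 x fun h => hx (Subtype.ext h), smul_zero]

/-- A balanced function which vanishes on the ladders with root `z` vanishes on all trees with
root `z`. -/
theorem IsBalanced.eq_zero_of_root [Fintype α] {M : Type*} [AddCommGroup M]
    {f : RTree α → M} (hf : IsBalanced f) {z : α}
    (h : ∀ T : RTree α, T.root = z → T.IsLadder → f T = 0) (T : RTree α) (hT : T.root = z) :
    f T = 0 := by
  -- All depths from 0 to that of `a` occur, so there are more vertices than the depth of `a`.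
  have hbdd : ∀ (T : RTree α) a, T.depth a < Fintype.card α := by
    intro T a
    have hsurj : ∀ j : Fin (T.depth a + 1), ∃ b, T.depth b = j := fun j =>
      T.exists_depth_eq a (by omega)
    choose g hg using hsurj
    have hinj : Function.Injective g := fun i j hij => Fin.ext (by rw [← hg i, ← hg j, hij])
    have := Fintype.card_le_of_injective g hinj
    simpa using this
  have hsum : ∀ T : RTree α, ∑ a, T.depth a ≤ Fintype.card α * Fintype.card α := by
    intro T
    refine (Finset.sum_le_card_nsmul _ _ (Fintype.card α) fun a _ => (hbdd T a).le).trans ?_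
    simp
  -- The total depth is bounded and grows whenever siblings are separated, so the induction runs on
  -- the distance to the bound.
  induction hn : Fintype.card α * Fintype.card α - ∑ a, T.depth a
    using Nat.strong_induction_on generalizing T with
  | _ n ih =>
    by_cases hl : T.IsLadder
    · exact h T hT hl
    · unfold IsLadder at hl
      push Not at hl
      obtain ⟨a, b, ha, hb, hp, hab⟩ := hl
      refine hf.eq_zero_of_insertAbove T hab ha hb hp fun x hx => ?_
      refine ih _ ?_ _ hT rfl
      have hlt : ∑ a, T.depth a <
          ∑ y, ((T.insertAbove (T.parent a)).contract x).depth y := by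
        refine Finset.sum_lt_sum (fun y _ => (depth_le_insertAbove T _ x hx y).1) ?_
        -- At least one of the siblings `a`, `b` differs from `x` and is moved strictly deeper.
        by_cases hax : a = x.1
        · exact ⟨b, Finset.mem_univ _,
            (depth_le_insertAbove T _ x hx b).2 hp.symm hb (fun h => hab (hax.trans h.symm))⟩
        · exact ⟨a, Finset.mem_univ _, (depth_le_insertAbove T _ x hx a).2 rfl ha hax⟩
      have := hsum ((T.insertAbove (T.parent a)).contract x)
      omega

open Classical in
/-- The tree obtained by inserting the special vertex, as the new root, between the root and its
child `c`. -/
def insertRoot (T : RTree α) (c : α) : RTree (Option α) :=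
  ofRank none
    (fun o => o.elim none
      fun y => if y = c ∨ y = T.root then none else some (T.parent y))
    rfl
    (fun o => o.elim 0 fun y => T.depth y + 1)
    (by
      rintro (_ | y) hy
      · exact absurd rfl hy
      · by_cases h : y = c ∨ y = T.root
        · simp [h]
        · simp [h]
          rw [not_or] at h
          have := T.depth_parent h.2
          omega)

@[simp] theorem insertRoot_parent_none (T : RTree α) (c : α) :
    (T.insertRoot c).parent none = none := rfl

theorem insertRoot_parent_some (T : RTree α) {c y : α} (h : y = c ∨ y = T.root) :
    (T.insertRoot c).parent (some y) = none := if_pos h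

theorem insertRoot_parent_some_of_not (T : RTree α) {c y : α} (h : ¬(y = c ∨ y = T.root)) :
    (T.insertRoot c).parent (some y) = some (T.parent y) := if_neg h

theorem isSpecialEdge_insertRoot {T : RTree α} {c x : α} :
    IsSpecialEdge (T.insertRoot c) x ↔ x = c ∨ x = T.root := by
  rw [isSpecialEdge_iff, insertRoot_parent_none]
  by_cases h : x = c ∨ x = T.root
  · simp [insertRoot_parent_some _ h, h]
  · simp [insertRoot_parent_some_of_not _ h, h]

/-- The special root of `T.insertRoot c` has just the two incoming edges from `c` and the old root.
Contracting one of them recovers `T`; contracting the other gives `T` rerooted at `c`. -/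
theorem insertRoot_contract_root (T : RTree α) {c : α} (hc : T.parent c = T.root)
    (h : IsSpecialEdge (T.insertRoot c) T.root) : (T.insertRoot c).contract ⟨T.root, h⟩ = T := by
  refine ext_of_parent (funext fun y => ?_)
  by_cases hy : y = T.root
  · subst hy
    rw [contract_parent, contractParent_self (insertRoot_parent_some _ (Or.inr rfl)), T.parent_root]
    rfl
  · rw [parent_contract_of_ne _ _ hy]
    by_cases hyc : y = c
    · subst hyc
      rw [insertRoot_parent_some _ (Or.inl rfl), hc]
      rfl
    · rw [insertRoot_parent_some_of_not _ (by tauto)]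
      rfl

/-- A balanced function changes its sign if the root is moved to a neighbour. -/
theorem IsBalanced.eq_neg_insertRoot [Fintype α] {M : Type*} [AddCommGroup M]
    {f : RTree α → M} (hf : IsBalanced f) (T : RTree α) {c : α} (hc : T.parent c = T.root)
    (hcr : c ≠ T.root) :
    f T = - f ((T.insertRoot c).contract ⟨c, isSpecialEdge_insertRoot.2 (Or.inl rfl)⟩) := by
  classical
  have har : 2 ≤ (T.insertRoot c).arity none :=
    two_le_arity _ (x := some c) (y := some T.root) (fun h => hcr (Option.some.inj h))
      ⟨by simp, insertRoot_parent_some _ (Or.inl rfl)⟩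
      ⟨by simp, insertRoot_parent_some _ (Or.inr rfl)⟩
  have key := hf _ har
  rw [Fintype.sum_eq_add ⟨c, isSpecialEdge_insertRoot.2 (Or.inl rfl)⟩
      ⟨T.root, isSpecialEdge_insertRoot.2 (Or.inr rfl)⟩ (fun h => hcr (congrArg Subtype.val h)),
    insertRoot_contract_root _ hc, sign_of_parent _ (insertRoot_parent_some _ (Or.inl rfl)),
    sign_of_parent _ (insertRoot_parent_some _ (Or.inr rfl)), one_smul, one_smul] at key
  · exact eq_neg_of_add_eq_zero_right key
  · rintro ⟨x, hx⟩ ⟨h1, h2⟩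
    rcases isSpecialEdge_insertRoot.1 hx with rfl | rfl
    · exact absurd rfl h1
    · exact absurd rfl h2

/-- A balanced function which vanishes on the ladders with root `z` vanishes. -/
theorem IsBalanced.eq_zero [Fintype α] {M : Type*} [AddCommGroup M]
    {f : RTree α → M} (hf : IsBalanced f) (z : α)
    (h : ∀ T : RTree α, T.root = z → T.IsLadder → f T = 0) (T : RTree α) : f T = 0 := by
  -- Induction on the distance from `z` to the root: each move of the root to its child on the path
  -- from `z` shortens this distance.
  suffices H : ∀ (m : ℕ) (T : RTree α), (∃ i ≤ m, T.parent^[i] z = T.root) → f T = 0 by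
    obtain ⟨m, hm⟩ := T.reaches_root z
    exact H m T ⟨m, le_rfl, hm⟩
  clear T
  intro m
  induction m with
  | zero =>
    rintro T ⟨i, hi, hT⟩
    obtain rfl : i = 0 := by omega
    exact hf.eq_zero_of_root h T hT.symm
  | succ m ih =>
    rintro T ⟨i, hi, hT⟩
    by_cases hm : ∃ i ≤ m, T.parent^[i] z = T.root
    · exact ih T hm
    push Not at hm
    obtain rfl : i = m + 1 := by
      by_contra hne
      exact hm i (by omega) hT
    set c := T.parent^[m] z with hcdef
    have hc : T.parent c = T.root := by rw [← hT, Function.iterate_succ_apply']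
    rw [hf.eq_neg_insertRoot T hc (hm m le_rfl), ih _ ?_, neg_zero]
    set T' := (T.insertRoot c).contract ⟨c, isSpecialEdge_insertRoot.2 (Or.inl rfl)⟩ with hT'
    -- Before reaching `c`, the path meets neither `c` nor the old root, and the parents of all
    -- other vertices are unchanged by the rerooting.
    have key : ∀ (j : ℕ) (y : α), T.parent^[j] y = c → ∃ i ≤ j, T'.parent^[i] y = c := by
      intro j
      induction j with
      | zero => intro y hy; exact ⟨0, le_rfl, hy⟩
      | succ j ihj =>
        intro y hy
        by_cases hyc : y = c
        · exact ⟨0, by omega, hyc⟩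
        · have hyr : y ≠ T.root := by
            rintro rfl
            rw [parent_iterate_root] at hy
            exact hm m le_rfl hy.symm
          rw [Function.iterate_succ_apply] at hy
          obtain ⟨i, hi, h'⟩ := ihj _ hy
          refine ⟨i + 1, by omega, ?_⟩
          rw [Function.iterate_succ_apply, hT', parent_contract_of_ne _ _ hyc,
            insertRoot_parent_some_of_not _ (by tauto), collapse_some]
          exact h'
    exact key m z rfl

/-! ### The coefficients of iterated brackets -/

/-- Every vertex has at most one neighbour of smaller rank. -/
def IsIncreasing (ρ : α → ℕ) (T : RTree α) : Prop :=
  ∀ i j l, T.Adj i j → T.Adj i l → ρ j < ρ i → ρ l < ρ i → j = l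

/-- The sign of the edge which starts at `i`. -/
def edgeSign (ρ : α → ℕ) (T : RTree α) (i : α) : ℤ := if ρ i < ρ (T.parent i) then -1 else 1

open Classical in
/-- The coefficient of the tree `T` in the left normed bracket `[…[[v₀, v₁], v₂], …]` of its
vertices, ordered by their rank. -/
def bracketCoeff [Fintype α] (ρ : α → ℕ) (T : RTree α) : ℤ :=
  if IsIncreasing ρ T then ∏ i, edgeSign ρ T i else 0

theorem bracketCoeff_of_increasing [Fintype α] {ρ : α → ℕ} {T : RTree α} (h : IsIncreasing ρ T) :
    bracketCoeff ρ T = ∏ i, edgeSign ρ T i := if_pos h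

theorem bracketCoeff_of_not [Fintype α] {ρ : α → ℕ} {T : RTree α} (h : ¬IsIncreasing ρ T) :
    bracketCoeff ρ T = 0 := if_neg h

theorem adj_relabel (e : α ≃ β) (T : RTree α) (a b : α) :
    (T.relabel e).Adj (e a) (e b) ↔ T.Adj a b := by
  simp only [Adj, edge_relabel]

theorem bracketCoeff_relabel [Fintype α] [Fintype β] (e : α ≃ β) (ρ : β → ℕ) (T : RTree α) :
    bracketCoeff ρ (T.relabel e) = bracketCoeff (ρ ∘ e) T := by
  have h : IsIncreasing ρ (T.relabel e) ↔ IsIncreasing (ρ ∘ e) T := by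
    unfold IsIncreasing
    simp only [← e.forall_congr_right (q := fun _ => _), adj_relabel, e.apply_eq_iff_eq,
      Function.comp_apply]
  by_cases hT : IsIncreasing (ρ ∘ e) T
  · rw [bracketCoeff_of_increasing hT, bracketCoeff_of_increasing (h.2 hT)]
    refine (Fintype.prod_equiv e _ _ fun i => ?_).symm
    simp [edgeSign]
  · rw [bracketCoeff_of_not hT, bracketCoeff_of_not (fun h' => hT (h.1 h'))]

theorem not_adj_of_isSpecialEdge {S : RTree (Option α)} {x y : α} (hx : IsSpecialEdge S x)
    (hy : IsSpecialEdge S y) : ¬S.Adj (some x) (some y) :=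
  Adj.not_adj (Adj.symm hx) (Adj.symm hy)

/-- Here `m₁` and `m₂` are the two smallest neighbours of the special vertex. Contracting the edge
to any other `x` makes both of them smaller neighbours of `x`, so only two terms of the balance
condition can survive. -/
theorem not_isIncreasing_contract {S : RTree (Option α)} {ρ : α → ℕ} {m₁ m₂ : α}
    (h₁ : IsSpecialEdge S m₁) (h₂ : IsSpecialEdge S m₂) (h₁₂ : ρ m₁ < ρ m₂)
    (hmin : ∀ x, IsSpecialEdge S x → x ≠ m₁ → x ≠ m₂ → ρ m₂ < ρ x)
    (x : {x // IsSpecialEdge S x}) (hx₁ : x.1 ≠ m₁)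
    (hx₂ : x.1 ≠ m₂) : ¬IsIncreasing ρ (S.contract x) := by
  intro h
  have h' := hmin x x.2 hx₁ hx₂
  have := h x.1 m₁ m₂ ((adj_contract S x _ _).2 ⟨hx₁, Or.inr (Or.inl ⟨rfl, h₁⟩)⟩)
    ((adj_contract S x _ _).2 ⟨hx₂, Or.inr (Or.inl ⟨rfl, h₂⟩)⟩) (by omega) h'
  rw [this] at h₁₂
  exact lt_irrefl _ h₁₂

/-- The right side does not involve `x`, so the contractions at `m₁` and at `m₂` are both increasing
or both not. In either one, every former neighbour of the special vertex except `m₁` gains exactly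
one smaller neighbour, hence must have had none among the ordinary vertices. -/
theorem isIncreasing_contract_iff {S : RTree (Option α)} {ρ : α → ℕ} {m₁ m₂ : α}
    (h₁ : IsSpecialEdge S m₁) (h₂ : IsSpecialEdge S m₂) (h₁₂ : ρ m₁ < ρ m₂)
    (hmin : ∀ x, IsSpecialEdge S x → x ≠ m₁ → x ≠ m₂ → ρ m₂ < ρ x)
    (x : {x // IsSpecialEdge S x}) (hx : x.1 = m₁ ∨ x.1 = m₂) :
    IsIncreasing ρ (S.contract x) ↔
      (∀ i j j', S.Adj (some i) (some j) → S.Adj (some i) (some j') → ρ j < ρ i → ρ j' < ρ i →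
        j = j') ∧
      ∀ i j, IsSpecialEdge S i → i ≠ m₁ → S.Adj (some i) (some j) → ¬ρ j < ρ i := by
  classical
  have hne : m₁ ≠ m₂ := fun h => by rw [h] at h₁₂; exact lt_irrefl _ h₁₂
  have hmin₁ : ∀ x, IsSpecialEdge S x → x ≠ m₁ → ρ m₁ < ρ x := by
    intro x hx hx₁
    by_cases hx₂ : x = m₂
    · rwa [hx₂]
    · exact h₁₂.trans (hmin x hx hx₁ hx₂)
  -- The gained smaller neighbour is `m₁` for the vertex `m₂`, and the merged vertex for all larger
  -- ones.
  have key : ∀ i j, (S.contract x).Adj i j ∧ ρ j < ρ i ↔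
      (S.Adj (some i) (some j) ∧ ρ j < ρ i) ∨
        (IsSpecialEdge S i ∧ i ≠ m₁ ∧ j = if i = m₂ then m₁ else x.1) := by
    intro i j
    rw [adj_contract]
    constructor
    · rintro ⟨⟨hij, h | ⟨rfl, h⟩ | ⟨rfl, h⟩⟩, hlt⟩
      · exact Or.inl ⟨h, hlt⟩
      · rcases hx with hx | hx
        · rw [hx] at hlt hij
          exact absurd (hmin₁ j h hij.symm) (by omega)
        · have : j = m₁ := by
            by_contra hj
            rw [hx] at hlt hij
            exact absurd (hmin j h hj hij.symm) (by omega)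
          exact Or.inr ⟨x.2, by rw [hx]; exact hne.symm, by rw [if_pos hx, this]⟩
      · refine Or.inr ⟨h, ?_, ?_⟩
        · rintro rfl
          rcases hx with hx | hx
          · exact hij hx.symm
          · rw [hx] at hlt; omega
        · split_ifs with hi
          · rcases hx with hx | hx
            · exact hx
            · exact absurd (hi.trans hx.symm) hij
          · rfl
    · rintro (⟨h, hlt⟩ | ⟨h, hi, rfl⟩)
      · exact ⟨⟨fun h' => h.ne (congrArg some h'), Or.inl h⟩, hlt⟩
      · split_ifs with hi₂
        · subst hi₂
          refine ⟨⟨hi, ?_⟩, h₁₂⟩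
          rcases hx with hx | hx
          · exact Or.inr (Or.inr ⟨hx.symm, h⟩)
          · exact Or.inr (Or.inl ⟨hx.symm, h₁⟩)
        · have hix : i ≠ x.1 := by rcases hx with hx | hx <;> rw [hx] <;> assumption
          refine ⟨⟨hix, Or.inr (Or.inr ⟨rfl, h⟩)⟩, ?_⟩
          rcases hx with hx | hx <;> rw [hx]
          · exact hmin₁ i h hi
          · exact hmin i h hi hi₂
  have hb : ∀ i, IsSpecialEdge S (if i = m₂ then m₁ else x.1) := by
    intro i
    split_ifs
    exacts [h₁, x.2]
  constructor
  · intro h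
    refine ⟨fun i j j' hj hj' hlt hlt' => ?_, fun i j hi him hj hlt => ?_⟩
    · have a := (key i j).2 (Or.inl ⟨hj, hlt⟩)
      have b := (key i j').2 (Or.inl ⟨hj', hlt'⟩)
      exact h i j j' a.1 b.1 a.2 b.2
    · have a := (key i j).2 (Or.inl ⟨hj, hlt⟩)
      have b := (key i _).2 (Or.inr ⟨hi, him, rfl⟩)
      have := h i _ _ a.1 b.1 a.2 b.2
      rw [this] at hj
      -- The gained neighbour is itself adjacent to the special vertex, so it differs from old
      -- neighbours because trees have no triangles.
      exact not_adj_of_isSpecialEdge hi (hb i) hj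
  · rintro ⟨ha, hb'⟩ i j j' hj hj' hlt hlt'
    rcases (key i j).1 ⟨hj, hlt⟩ with ⟨a1, a2⟩ | ⟨a1, a2, a3⟩ <;>
      rcases (key i j').1 ⟨hj', hlt'⟩ with ⟨b1, b2⟩ | ⟨b1, b2, b3⟩
    · exact ha i j j' a1 b1 a2 b2
    · exact absurd a2 (hb' i j b1 b2 a1)
    · exact absurd b2 (hb' i j' a1 a2 b1)
    · rw [a3, b3]

/-- Both `m₁` and `m₂` are smaller than the remaining neighbours, so the signs of edges starting
elsewhere agree. If both point to the special vertex, the blow-up signs agree, but the edge between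
`m₁` and `m₂` is reversed from one contraction to the other. If one of them is the target of the
outgoing edge, all edge signs agree and the blow-up signs are opposite. -/
theorem sign_mul_prod_edgeSign {S : RTree (Option α)} {ρ : α → ℕ} {m₁ m₂ : α}
    (h₁ : IsSpecialEdge S m₁) (h₂ : IsSpecialEdge S m₂) (h₁₂ : ρ m₁ < ρ m₂)
    (hmin : ∀ x, IsSpecialEdge S x → x ≠ m₁ → x ≠ m₂ → ρ m₂ < ρ x)
    [Fintype α] :
    sign (S, m₁) * ∏ i, edgeSign ρ (S.contract ⟨m₁, h₁⟩) i =
      -(sign (S, m₂) * ∏ i, edgeSign ρ (S.contract ⟨m₂, h₂⟩) i) := by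
  classical
  have hne : m₁ ≠ m₂ := fun h => by rw [h] at h₁₂; exact lt_irrefl _ h₁₂
  have hsplit : ∀ s : α → ℤ, ∏ i, s i = s m₁ * (s m₂ * ∏ i ∈ (Finset.univ.erase m₁).erase m₂, s i) := by
    intro s
    rw [Finset.mul_prod_erase _ _ (Finset.mem_erase.2 ⟨hne.symm, Finset.mem_univ _⟩),
      Finset.mul_prod_erase _ _ (Finset.mem_univ _)]
  have hrest : ∏ i ∈ (Finset.univ.erase m₁).erase m₂, edgeSign ρ (S.contract ⟨m₁, h₁⟩) i =
      ∏ i ∈ (Finset.univ.erase m₁).erase m₂, edgeSign ρ (S.contract ⟨m₂, h₂⟩) i := by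
    refine Finset.prod_congr rfl fun i hi => ?_
    rw [Finset.mem_erase, Finset.mem_erase] at hi
    obtain ⟨hi₂, hi₁, -⟩ := hi
    unfold edgeSign
    rw [parent_contract_of_ne _ _ hi₁, parent_contract_of_ne _ _ hi₂]
    rcases hp : S.parent (some i) with _ | q
    · have h2 := hmin i (isSpecialEdge_iff.2 (Or.inl hp)) hi₁ hi₂
      have h1 := h₁₂.trans h2
      simp [h1.not_gt, h2.not_gt]
    · rfl
  have hnone : ∀ x, S.parent none = some x → S.parent (some x) ≠ none := by
    intro x hx hx'
    have e1 := S.depth_of_edge (a := none) (b := some x) ⟨by simp, hx⟩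
    have e2 := S.depth_of_edge (a := some x) (b := none) ⟨by simp, hx'⟩
    omega
  rw [hsplit, hsplit (edgeSign ρ (S.contract ⟨m₂, h₂⟩)), hrest]
  have e12 : edgeSign ρ (S.contract ⟨m₁, h₁⟩) m₂ =
      if ρ m₂ < ρ (collapse m₁ (S.parent (some m₂))) then -1 else 1 := by
    unfold edgeSign
    rw [parent_contract_of_ne _ _ hne.symm]
  have e21 : edgeSign ρ (S.contract ⟨m₂, h₂⟩) m₁ =
      if ρ m₁ < ρ (collapse m₂ (S.parent (some m₁))) then -1 else 1 := by
    unfold edgeSign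
    rw [parent_contract_of_ne _ _ hne]
  have e11 : edgeSign ρ (S.contract ⟨m₁, h₁⟩) m₁ =
      if ρ m₁ < ρ (contractParent S m₁ m₁) then -1 else 1 := rfl
  have e22 : edgeSign ρ (S.contract ⟨m₂, h₂⟩) m₂ =
      if ρ m₂ < ρ (contractParent S m₂ m₂) then -1 else 1 := rfl
  rw [e12, e21, e11, e22]
  rcases isSpecialEdge_iff.1 h₁ with p₁ | p₁ <;> rcases isSpecialEdge_iff.1 h₂ with p₂ | p₂
  · rw [contractParent_self p₁, contractParent_self p₂, sign_of_parent _ p₁, sign_of_parent _ p₂,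
      p₁, p₂, collapse_none, collapse_none, if_neg h₁₂.not_gt, if_pos h₁₂]
    rcases hp : S.parent none with _ | q
    · simp
    · have hq₁ : q ≠ m₁ := by rintro rfl; exact hnone _ hp p₁
      have hq₂ : q ≠ m₂ := by rintro rfl; exact hnone _ hp p₂
      have h2 := hmin q (isSpecialEdge_iff.2 (Or.inr hp)) hq₁ hq₂
      simp [h2, h₁₂.trans h2]
  · have := hnone _ p₂
    rw [contractParent_self p₁, contractParent_of_not fun h => this h.2, sign_of_parent _ p₁,
      sign_of_parent_none _ p₂, p₁, p₂]
    rcases hp : S.parent (some m₂) with _ | q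
    · exact absurd hp this
    · simp
      rfl
  · have := hnone _ p₁
    rw [contractParent_self p₂, contractParent_of_not fun h => this h.2, sign_of_parent _ p₂,
      sign_of_parent_none _ p₁, p₁, p₂]
    rcases hp : S.parent (some m₁) with _ | q
    · exact absurd hp this
    · simp [h₁₂.not_gt]
      exact Or.inl rfl
  · exact absurd (Option.some.inj (p₁.symm.trans p₂)) hne

/-- The coefficients of iterated brackets are balanced. -/
theorem isBalanced_bracketCoeff [Fintype α] {ρ : α → ℕ} (hρ : Function.Injective ρ)
    {M : Type*} [AddCommGroup M] (t : M) : IsBalanced fun T : RTree α => bracketCoeff ρ T • t := by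
  classical
  intro S hS
  obtain ⟨x, y, hxy, hx, hy⟩ := S.exists_of_two_le_arity hS
  rcases x with _ | x
  · exact absurd rfl hx.1
  rcases y with _ | y
  · exact absurd rfl hy.1
  let N : Finset α := Finset.univ.filter fun z => IsSpecialEdge S z
  have hN : ∀ z, z ∈ N ↔ IsSpecialEdge S z := fun z => by simp [N]
  -- Arity at least two guarantees two distinct neighbours, so a smallest and a second smallest one
  -- exist.
  obtain ⟨m₁, hm₁, hmin₁⟩ := N.exists_min_image ρ ⟨x, (hN x).2 (Or.inl hx)⟩
  have hne : (N.erase m₁).Nonempty := by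
    by_cases h : x = m₁
    · refine ⟨y, Finset.mem_erase.2 ⟨?_, (hN y).2 (Or.inl hy)⟩⟩
      rintro rfl
      exact hxy (congrArg some h)
    · exact ⟨x, Finset.mem_erase.2 ⟨h, (hN x).2 (Or.inl hx)⟩⟩
  obtain ⟨m₂, hm₂, hmin₂⟩ := (N.erase m₁).exists_min_image ρ hne
  rw [Finset.mem_erase] at hm₂
  have h₁ := (hN _).1 hm₁
  have h₂ := (hN _).1 hm₂.2
  have h₁₂ : ρ m₁ < ρ m₂ :=
    lt_of_le_of_ne (hmin₁ _ hm₂.2) fun h => hm₂.1 (hρ h).symm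
  have hmin : ∀ x, IsSpecialEdge S x → x ≠ m₁ → x ≠ m₂ → ρ m₂ < ρ x := fun x hx hx₁ hx₂ =>
    lt_of_le_of_ne (hmin₂ _ (Finset.mem_erase.2 ⟨hx₁, (hN _).2 hx⟩)) fun h => hx₂ (hρ h).symm
  rw [Fintype.sum_eq_add ⟨m₁, h₁⟩ ⟨m₂, h₂⟩ (fun h => hm₂.1 (congrArg Subtype.val h).symm)]
  · simp only [smul_smul, ← add_smul]
    by_cases h : IsIncreasing ρ (S.contract ⟨m₁, h₁⟩)
    · have h' : IsIncreasing ρ (S.contract ⟨m₂, h₂⟩) :=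
        (isIncreasing_contract_iff h₁ h₂ h₁₂ hmin ⟨m₂, h₂⟩ (Or.inr rfl)).2
          ((isIncreasing_contract_iff h₁ h₂ h₁₂ hmin ⟨m₁, h₁⟩ (Or.inl rfl)).1 h)
      rw [bracketCoeff_of_increasing h, bracketCoeff_of_increasing h',
        sign_mul_prod_edgeSign h₁ h₂ h₁₂ hmin, neg_add_cancel, zero_smul]
    · have h' : ¬IsIncreasing ρ (S.contract ⟨m₂, h₂⟩) := fun h' => h
        ((isIncreasing_contract_iff h₁ h₂ h₁₂ hmin ⟨m₁, h₁⟩ (Or.inl rfl)).2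
          ((isIncreasing_contract_iff h₁ h₂ h₁₂ hmin ⟨m₂, h₂⟩ (Or.inr rfl)).1 h'))
      rw [bracketCoeff_of_not h, bracketCoeff_of_not h']
      simp
  · rintro x ⟨hx₁, hx₂⟩
    beta_reduce
    rw [bracketCoeff_of_not (not_isIncreasing_contract h₁ h₂ h₁₂ hmin x
      (fun h => hx₁ (Subtype.ext h)) fun h => hx₂ (Subtype.ext h)), zero_smul, smul_zero]

/-! ### Values on ladders -/

/-- Each level of a ladder holds a single vertex, so depth is an admissible rank function. -/
theorem IsLadder.depth_injective {T : RTree α} (hT : T.IsLadder) : Function.Injective T.depth := by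
  intro a b h
  induction hn : T.depth a generalizing a b with
  | zero => exact (T.depth_eq_zero.1 hn).trans (T.depth_eq_zero.1 (h.symm.trans hn)).symm
  | succ n ih =>
    have ha : a ≠ T.root := by rintro rfl; simp at hn
    have hb : b ≠ T.root := by rintro rfl; simp [hn] at h
    have e1 := T.depth_parent ha
    have e2 := T.depth_parent hb
    exact hT a b ha hb (ih (by omega) (by omega))

/-- When vertices are ranked by depth, the only smaller neighbour is the parent, and no edge goes to
a larger rank. This is the diagonal part of the duality between ladders and brackets. -/
theorem bracketCoeff_depth_self [Fintype α] (T : RTree α) : bracketCoeff T.depth T = 1 := by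
  have h : IsIncreasing T.depth T := by
    intro i j j' hj hj' hlt hlt'
    have key : ∀ j, T.Adj i j → T.depth j < T.depth i → T.parent i = j := by
      rintro j (h | h) hlt
      · exact h.2
      · have := T.depth_of_edge h
        omega
    rw [← key j hj hlt, key j' hj' hlt']
  rw [bracketCoeff_of_increasing h]
  refine Finset.prod_eq_one fun i _ => if_neg ?_
  by_cases hi : i = T.root
  · rw [hi, T.parent_root]
    exact lt_irrefl _
  · have := T.depth_parent hi
    omega

/-- If the rank dropped from `T.parent i` to `i`, then `T.parent i` would have two smaller
neighbours, its own parent and `i`. Starting at a root of minimal rank, ranks therefore keep growing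
away from it. -/
theorem IsIncreasing.parent_lt {ρ : α → ℕ} (hρ : Function.Injective ρ) {T : RTree α}
    (h : IsIncreasing ρ T) (h0 : ρ T.root = 0) {i : α} (hi : i ≠ T.root) : ρ (T.parent i) < ρ i := by
  induction hn : T.depth i generalizing i with
  | zero => exact absurd (T.depth_eq_zero.1 hn) hi
  | succ n ih =>
    have e1 := T.depth_parent hi
    by_cases hp : T.parent i = T.root
    · rw [hp, h0]
      exact Nat.pos_of_ne_zero fun h' => hi (hρ (h'.trans h0.symm))
    · have hlt := ih hp (by omega)
      by_contra hge
      have hne : ρ i ≠ ρ (T.parent i) := fun h' => T.parent_ne hi (hρ h').symm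
      have := h (T.parent i) (T.parent (T.parent i)) i (Or.inl ⟨(T.parent_ne hp).symm, rfl⟩)
        (Or.inr ⟨(T.parent_ne hi).symm, rfl⟩) hlt (by omega)
      have e2 := T.depth_parent hp
      rw [this] at e2
      omega

/-- The off-diagonal part of the duality: a ladder with the same root along which the ranks of `L`
increase must visit the vertices in the order of `L`. -/
theorem bracketCoeff_depth_of_ne [Fintype α] {L T : RTree α} (hL : L.IsLadder) (hT : T.IsLadder)
    (hr : T.root = L.root) (hne : T ≠ L) : bracketCoeff L.depth T = 0 := by
  refine bracketCoeff_of_not fun h => hne ?_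
  have hlt : ∀ i, i ≠ T.root → L.depth (T.parent i) < L.depth i := fun i hi =>
    h.parent_lt hL.depth_injective (by rw [hr, L.depth_root]) hi
  refine ext_of_parent (funext fun i => ?_)
  induction hn : L.depth i using Nat.strong_induction_on generalizing i with
  | _ n ih =>
    by_cases hi : i = T.root
    · rw [hi, T.parent_root, hr, L.parent_root]
    · have hiL : i ≠ L.root := hr ▸ hi
      have h1 := hlt i hi
      have h2 := L.depth_parent hiL
      apply hL.depth_injective
      by_contra hd
      -- If `T` skipped a level of `L` before `i`, the skipped vertex `b` would by induction have
      -- the same parent in `T` as `i`, which a ladder forbids.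
      obtain ⟨b, hb⟩ := L.exists_depth_eq i (j := L.depth (T.parent i) + 1) h1
      have hbL : b ≠ L.root := by rintro rfl; simp at hb
      have hpb : L.parent b = T.parent i := by
        apply hL.depth_injective
        have := L.depth_parent hbL
        omega
      have := ih (L.depth b) (by omega) b rfl
      have hbi : b = i := hT b i (hr ▸ hbL) hi (this.trans hpb)
      subst hbi
      omega

/-! ### Adding a vertex -/

/-- Adding one element to a type. -/
def sumOneEquiv (α : Type*) : α ⊕ Fin 1 ≃ Option α where
  toFun := Sum.elim some fun _ => none
  invFun o := o.elim (Sum.inr 0) Sum.inl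
  left_inv := by
    rintro (x | x)
    · rfl
    · exact congrArg Sum.inr (Subsingleton.elim _ _)
  right_inv := by rintro (_ | x) <;> rfl

/-- Adding a new leaf, connected with the vertex `a`. -/
def addLeaf (T : RTree α) (a : α) : RTree (Option α) :=
  (T.graft a (single (Fin 1))).relabel (sumOneEquiv α)

/-- Adding a new root, connected with the old one. -/
def addRoot (T : RTree α) : RTree (Option α) :=
  ((single (Fin 1)).graft 0 T).relabel ((Equiv.sumComm _ _).trans (sumOneEquiv α))

@[simp] theorem addLeaf_root (T : RTree α) (a : α) : (T.addLeaf a).root = some T.root := rfl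

@[simp] theorem addLeaf_parent_some (T : RTree α) (a y : α) :
    (T.addLeaf a).parent (some y) = some (T.parent y) := rfl

@[simp] theorem addLeaf_parent_none (T : RTree α) (a : α) :
    (T.addLeaf a).parent none = some a := by
  have : (0 : Fin 1) = (single (Fin 1)).root := Subsingleton.elim _ _
  simp [addLeaf, sumOneEquiv, ← this]

@[simp] theorem addRoot_root (T : RTree α) : T.addRoot.root = none := rfl

@[simp] theorem addRoot_parent_none (T : RTree α) : T.addRoot.parent none = none := rfl

theorem addRoot_parent_some (T : RTree α) {y : α} (hy : y ≠ T.root) :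
    T.addRoot.parent (some y) = some (T.parent y) := by
  simp [addRoot, sumOneEquiv, hy]

@[simp] theorem addRoot_parent_root (T : RTree α) : T.addRoot.parent (some T.root) = none := by
  simp [addRoot, sumOneEquiv]

theorem adj_addLeaf (T : RTree α) (a : α) (x y : α) :
    (T.addLeaf a).Adj (some x) (some y) ↔ T.Adj x y := by
  simp [Adj, Edge]

theorem adj_addLeaf_none (T : RTree α) (a : α) (o : Option α) :
    (T.addLeaf a).Adj none o ↔ o = some a := by
  cases o <;> simp [Adj, Edge, eq_comm]

theorem adj_addRoot (T : RTree α) (x y : α) :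
    T.addRoot.Adj (some x) (some y) ↔ T.Adj x y := by
  have key : ∀ x y, T.addRoot.Edge (some x) (some y) ↔ T.Edge x y := by
    intro x y
    by_cases hx : x = T.root
    · subst hx
      simp [Edge, T.parent_root]
    · simp [Edge, addRoot_parent_some _ hx]
  simp only [Adj, key]

theorem adj_addRoot_none (T : RTree α) (o : Option α) :
    T.addRoot.Adj none o ↔ o = some T.root := by
  cases o with
  | none => simp [Adj, Edge]
  | some x =>
    by_cases hx : x = T.root
    · subst hx
      simp [Adj, Edge]
    · simp [Adj, Edge, addRoot_parent_some _ hx, hx]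

/-- A vertex of largest rank is never a smaller neighbour of another vertex, and with a single
neighbour it satisfies the condition itself. -/
theorem isIncreasing_option {ρ : Option α → ℕ} (hρ : ∀ x, ρ (some x) < ρ none) {T : RTree α}
    {T' : RTree (Option α)} (h : ∀ x y, T'.Adj (some x) (some y) ↔ T.Adj x y) {a : α}
    (h' : ∀ o, T'.Adj none o ↔ o = some a) :
    IsIncreasing ρ T' ↔ IsIncreasing (ρ ∘ some) T := by
  constructor
  · intro hi x y z hy hz hlt hlt'
    exact Option.some.inj (hi _ _ _ ((h _ _).2 hy) ((h _ _).2 hz) hlt hlt')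
  · rintro hi (_ | x) j j' hj hj' hlt hlt'
    · rw [(h' j).1 hj, (h' j').1 hj']
    · rcases j with _ | j
      · exact absurd (hρ x) hlt.not_gt
      rcases j' with _ | j'
      · exact absurd (hρ x) hlt'.not_gt
      exact congrArg some (hi x j j' ((h _ _).1 hj) ((h _ _).1 hj') hlt hlt')

theorem bracketCoeff_addLeaf [Fintype α] {ρ : Option α → ℕ} (hρ : ∀ x, ρ (some x) < ρ none)
    (T : RTree α) (a : α) : bracketCoeff ρ (T.addLeaf a) = bracketCoeff (ρ ∘ some) T := by
  have hi := isIncreasing_option hρ (T.adj_addLeaf a) (T.adj_addLeaf_none a)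
  by_cases h : IsIncreasing (ρ ∘ some) T
  · rw [bracketCoeff_of_increasing h, bracketCoeff_of_increasing (hi.2 h), Fintype.prod_option]
    have : edgeSign ρ (T.addLeaf a) none = 1 := by
      simp [edgeSign, (hρ a).le]
    rw [this, one_mul]
    rfl
  · rw [bracketCoeff_of_not h, bracketCoeff_of_not (fun h' => h (hi.1 h'))]

/-- The old root acquires an edge towards the larger rank of the new root, which contributes the
factor `-1`; the other edges are unchanged. -/
theorem bracketCoeff_addRoot [Fintype α] {ρ : Option α → ℕ} (hρ : ∀ x, ρ (some x) < ρ none)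
    (T : RTree α) : bracketCoeff ρ T.addRoot = -bracketCoeff (ρ ∘ some) T := by
  classical
  have hi := isIncreasing_option hρ T.adj_addRoot T.adj_addRoot_none
  by_cases h : IsIncreasing (ρ ∘ some) T
  · rw [bracketCoeff_of_increasing h, bracketCoeff_of_increasing (hi.2 h), Fintype.prod_option,
      ← Finset.mul_prod_erase Finset.univ _ (Finset.mem_univ T.root),
      ← Finset.mul_prod_erase Finset.univ (edgeSign (ρ ∘ some) T) (Finset.mem_univ T.root)]
    have e1 : edgeSign ρ T.addRoot none = 1 := by simp [edgeSign]
    have e2 : edgeSign ρ T.addRoot (some T.root) = -1 := by simp [edgeSign, hρ]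
    have e3 : edgeSign (ρ ∘ some) T T.root = 1 := by simp [edgeSign, T.parent_root]
    rw [e1, e2, e3, one_mul, one_mul, neg_one_mul]
    refine congrArg _ (Finset.prod_congr rfl fun y hy => ?_)
    have hy := (Finset.mem_erase.1 hy).1
    simp [edgeSign, addRoot_parent_some _ hy]
  · rw [bracketCoeff_of_not h, bracketCoeff_of_not (fun h' => h (hi.1 h')), neg_zero]

/-- A tree in which the new vertex has at most one neighbour is obtained by adding this vertex to a
smaller tree. -/
theorem exists_eq_addLeaf_or_addRoot [Nonempty α] (T : RTree (Option α))
    (h : ∀ o o', T.Adj none o → T.Adj none o' → o = o') :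
    (∃ (S : RTree α) (a : α), T = S.addLeaf a) ∨ ∃ S : RTree α, T = S.addRoot := by
  rcases hp : T.parent none with _ | p
  · right
    have hr : T.root = none := (T.parent_eq_self.1 hp).symm
    obtain ⟨y⟩ := ‹Nonempty α›
    have hy : some y ≠ T.root := by simp [hr]
    -- A vertex of depth one is a child of the special root, and by hypothesis its only neighbour;
    -- contracting this edge gives the smaller tree.
    obtain ⟨b, hb⟩ := T.exists_depth_eq (some y) (j := 1) (by rw [T.depth_parent hy]; omega)
    have hbr : b ≠ T.root := by rintro rfl; simp at hb
    rcases b with _ | c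
    · exact absurd hr.symm hbr
    have hc : T.parent (some c) = none := by
      rw [T.depth_parent hbr] at hb
      rw [← hr]
      exact T.depth_eq_zero.1 (by omega)
    have hsp : IsSpecialEdge T c := isSpecialEdge_iff.2 (Or.inl hc)
    refine ⟨T.contract ⟨c, hsp⟩, ext_of_parent (funext ?_)⟩
    rintro (_ | z)
    · exact hp
    · by_cases hz : z = (T.contract ⟨c, hsp⟩).root
      · have e : some z = some c := by
          rw [hz, contract_root, hr]
          rfl
        rw [hz, addRoot_parent_root, ← hz, e, hc]
      · have hzc : z ≠ c := by
          rintro rfl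
          apply hz
          rw [contract_root, hr]
          rfl
        rw [addRoot_parent_some _ hz, parent_contract_of_ne _ _ hzc]
        rcases hq : T.parent (some z) with _ | q
        · exact absurd (Option.some.inj (h (some z) (some c) (Or.inr ⟨by simp, hq⟩)
            (Or.inr ⟨by simp, hc⟩))) hzc
        · rfl
  · left
    have hsp : IsSpecialEdge T p := isSpecialEdge_iff.2 (Or.inr hp)
    refine ⟨T.contract ⟨p, hsp⟩, p, ext_of_parent (funext ?_)⟩
    have hleaf : ∀ z, T.parent (some z) ≠ none := by
      intro z hz
      have e := h (some z) (some p) (Or.inr ⟨by simp, hz⟩) (Or.inl ⟨by simp, hp⟩)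
      have e1 := T.depth_of_edge (a := none) (b := some p) ⟨by simp, hp⟩
      have e2 := T.depth_of_edge (a := some z) (b := none) ⟨by simp, hz⟩
      rw [e] at e2
      omega
    rintro (_ | z)
    · rw [hp, addLeaf_parent_none]
    · rw [addLeaf_parent_some, contract_parent, contractParent_of_not fun h => hleaf _ h.2]
      rcases hq : T.parent (some z) with _ | q
      · exact absurd hq (hleaf z)
      · rfl

/-- The trees obtained by adding a vertex to a tree, as a leaf or as the root. -/
def addVertex (p : RTree α × Option α) : RTree (Option α) := p.2.elim p.1.addRoot p.1.addLeaf

theorem addVertex_injective : Function.Injective (addVertex (α := α)) := by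
  have hL : ∀ (S T : RTree α) (a b : α), S.addLeaf a = T.addLeaf b → S = T ∧ a = b := by
    intro S T a b h
    refine ⟨ext_of_parent (funext fun y => ?_), ?_⟩
    · have := congrArg (fun R => R.parent (some y)) h
      simpa using this
    · have := congrArg (fun R => R.parent none) h
      simpa using this
  have hR : ∀ S T : RTree α, S.addRoot = T.addRoot → S = T := by
    intro S T h
    refine ext_of_edge fun a b => ?_
    have key : ∀ S : RTree α, S.addRoot.Edge (some a) (some b) ↔ S.Edge a b := by
      intro S
      by_cases ha : a = S.root
      · subst ha
        simp [Edge, S.parent_root]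
      · simp [Edge, addRoot_parent_some _ ha]
    rw [← key, h, key]
  rintro ⟨S, a⟩ ⟨T, b⟩ h
  rcases a with _ | a <;> rcases b with _ | b
  · exact congrArg (·, none) (hR _ _ h)
  · have := congrArg RTree.root h
    simp [addVertex] at this
  · have := congrArg RTree.root h
    simp [addVertex] at this
  · obtain ⟨h1, h2⟩ := hL _ _ _ _ h
    exact Prod.ext h1 (congrArg some h2)

/-- The recursion for the coefficients of left normed brackets. -/
theorem sum_bracketCoeff_option [Fintype α] [Nonempty α] {ρ : Option α → ℕ}
    (hρ : ∀ x, ρ (some x) < ρ none) {M : Type*} [AddCommGroup M] (g : RTree (Option α) → M) :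
    ∑ T, bracketCoeff ρ T • g T =
      ∑ T : RTree α, bracketCoeff (ρ ∘ some) T • (∑ a, g (T.addLeaf a) - g T.addRoot) := by
  classical
  have h1 : ∑ p : RTree α × Option α, bracketCoeff ρ (addVertex p) • g (addVertex p) =
      ∑ T, bracketCoeff ρ T • g T := by
    refine Finset.sum_of_injOn addVertex addVertex_injective.injOn (fun _ _ => Finset.mem_univ _)
      ?_ fun _ _ => rfl
    intro T _ hT
    -- All neighbours of the last vertex have smaller rank, so in an increasing tree it has at most
    -- one, and the tree comes from `addVertex`.
    rw [bracketCoeff_of_not, zero_smul]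
    intro hi
    refine hT ?_
    have hnb : ∀ o, T.Adj none o → ρ o < ρ none := by
      rintro (_ | x) h
      · exact absurd rfl h.ne
      · exact hρ x
    rcases T.exists_eq_addLeaf_or_addRoot fun o o' ho ho' =>
        hi none o o' ho ho' (hnb o ho) (hnb o' ho') with ⟨S, a, h⟩ | ⟨S, h⟩
    · exact ⟨(S, some a), by simp, h.symm⟩
    · exact ⟨(S, none), by simp, h.symm⟩
  rw [← h1, Fintype.sum_prod_type]
  refine Finset.sum_congr rfl fun T _ => ?_
  rw [Fintype.sum_option]
  simp only [addVertex, Option.elim_none, Option.elim_some, bracketCoeff_addRoot hρ,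
    bracketCoeff_addLeaf hρ, smul_sub, Finset.smul_sum, neg_smul]
  abel

end RTree

/-! ### Iterated grafting. -/

section Graft

variable {α β γ : Type*}

/-- These terms occur in both bracketings of a triple product and cancel in the associator. -/
theorem graft_graft_inr (T : RTree α) (S : RTree β) (R : RTree γ) (a : α) (b : β) :
    ((T.graft a S).graft (Sum.inr b) R).relabel (Equiv.sumAssoc α β γ) =
      T.graft a (S.graft b R) := by
  refine RTree.ext_of_parent (funext ?_)
  rintro (x | y | z)
  · simp
  · by_cases h : y = S.root <;> simp [h]
  · by_cases h : z = R.root <;> simp [h]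

/-- The associativity of disjoint unions, combined with a transposition. -/
def sumRightComm (α β γ : Type*) : (α ⊕ β) ⊕ γ ≃ (α ⊕ γ) ⊕ β :=
  ((Equiv.sumAssoc α β γ).trans (Equiv.sumCongr (Equiv.refl α) (Equiv.sumComm β γ))).trans
    (Equiv.sumAssoc α γ β).symm

/-- Grafting two trees independently onto `T` does not depend on the order; this is the source of
the pre-Lie symmetry. -/
theorem graft_graft_inl (T : RTree α) (S : RTree β) (R : RTree γ) (a b : α) :
    ((T.graft a S).graft (Sum.inl b) R).relabel (sumRightComm α β γ) =
      (T.graft b R).graft (Sum.inl a) S := by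
  refine RTree.ext_of_parent (funext ?_)
  rintro ((x | z) | y)
  · simp [sumRightComm]
  · by_cases h : z = R.root <;> simp [sumRightComm, h]
  · by_cases h : y = S.root <;> simp [sumRightComm, h]

end Graft

/-! ### Decorated trees on arbitrary finite sets of vertices -/

section Generators

variable {k : Type*} [CommRing k] {V W : Type*} [AddCommGroup V] [Module k V]
  [AddCommGroup W] [Module k W]

theorem Tr.induction {p : Tr k V → Prop} (zero : p 0) (add : ∀ x y, p x → p y → p (x + y))
    (smul : ∀ (r : k) x, p x → p (r • x))
    (of : ∀ (n : ℕ) (T : RTree (Fin n)) (w : Fin n → V), p (Tr.of k T w)) (x : Tr k V) : p x := by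
  classical
  have key : ∀ n (z : Decorated k V n (RTree (Fin n))),
      p (DirectSum.lof k ℕ (fun n => Decorated k V n (RTree (Fin n))) n z) := by
    intro n z
    obtain ⟨z, rfl⟩ := Decorated.mk_surjective k V n (RTree (Fin n)) z
    induction z using Finsupp.induction_linear with
    | zero => rwa [map_zero, map_zero]
    | add a b ha hb =>
      rw [map_add, map_add]
      exact add _ _ ha hb
    | single T t =>
      induction t using PiTensorProduct.induction_on with
      | add a b ha hb =>
        rw [Finsupp.single_add, map_add, map_add]
        exact add _ _ ha hb
      | smul_tprod r w =>
        rw [← Finsupp.smul_single, map_smul, map_smul]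
        exact smul _ _ (of n T w)
  induction x using DirectSum.induction_on with
  | zero => exact zero
  | of n z => exact key n z
  | add a b ha hb => exact add _ _ ha hb

theorem Tr.hom_ext {U : Type*} [AddCommGroup U] [Module k U] {f g : Tr k V →ₗ[k] U}
    (h : ∀ (n : ℕ) (T : RTree (Fin n)) (w : Fin n → V), f (Tr.of k T w) = g (Tr.of k T w)) :
    f = g := by
  refine LinearMap.ext fun x => ?_
  induction x using Tr.induction with
  | zero => rw [map_zero, map_zero]
  | add x y hx hy => rw [map_add, map_add, hx, hy]
  | smul r x hx => rw [map_smul, map_smul, hx]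
  | of n T w => exact h n T w

/-- In coinvariants the numbering of the vertices is immaterial. This is what makes `Tr.gen`
independent of choices. -/
theorem Tr.of_relabel {m n : ℕ} (e : Fin m ≃ Fin n) (T : RTree (Fin m)) (w : Fin m → V) :
    Tr.of k (T.relabel e) (w ∘ e.symm) = Tr.of k T w := by
  obtain rfl : m = n := by simpa using Fintype.card_congr e
  have := Decorated.mk_diag k V m (RTree (Fin m)) e (Finsupp.single T (PiTensorProduct.tprod k w))
  rw [diag_single, permTensor_tprod] at this
  exact congrArg (DirectSum.lof k ℕ (fun n => Decorated k V n (RTree (Fin n))) m) this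

variable (k) in
/-- The tree `T`, with a finite set of vertices, decorated by `w`. -/
def Tr.gen {α : Type*} [Fintype α] (T : RTree α) (w : α → V) : Tr k V :=
  Tr.of k (T.relabel (Fintype.equivFin α)) (w ∘ (Fintype.equivFin α).symm)

variable {α β γ : Type*} [Fintype α] [Fintype β] [Fintype γ]

theorem Tr.gen_eq_of {n : ℕ} (e : α ≃ Fin n) (T : RTree α) (w : α → V) :
    Tr.gen k T w = Tr.of k (T.relabel e) (w ∘ e.symm) := by
  rw [Tr.gen, ← Tr.of_relabel ((Fintype.equivFin α).symm.trans e), RTree.relabel_relabel]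
  congr 1
  · congr 1
    ext x
    simp
  · funext x
    simp

theorem Tr.gen_fin {n : ℕ} (T : RTree (Fin n)) (w : Fin n → V) :
    Tr.gen k T w = Tr.of k T w := by
  rw [Tr.gen_eq_of (Equiv.refl _), RTree.relabel_refl]
  rfl

theorem Tr.gen_relabel (e : α ≃ β) (T : RTree α) (w : α → V) :
    Tr.gen k (T.relabel e) (w ∘ e.symm) = Tr.gen k T w := by
  rw [Tr.gen_eq_of (Fintype.equivFin β), Tr.gen_eq_of (e.trans (Fintype.equivFin β)),
    RTree.relabel_relabel]
  rfl

theorem Tr.star_of {m n : ℕ} (T : RTree (Fin m)) (S : RTree (Fin n)) (w : Fin m → V)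
    (u : Fin n → V) :
    star k V (Tr.of k T w) (Tr.of k S u) = ∑ a, Tr.gen k (T.graft a S) (Sum.elim w u) := by
  simp only [star, Tr.of, DirectSum.toModule_lof, LinearMap.flip_apply, LinearMap.compr₂_apply,
    starHom, Decorated.of, Decorated.lift_mk, starTensor_single, map_sum, concat_tprod]
  refine Finset.sum_congr rfl fun a _ => ?_
  rw [Tr.gen_eq_of finSumFinEquiv]
  rfl

theorem Tr.star_gen (T : RTree α) (S : RTree β) (w : α → V) (u : β → V) :
    star k V (Tr.gen k T w) (Tr.gen k S u) = ∑ a, Tr.gen k (T.graft a S) (Sum.elim w u) := by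
  rw [Tr.gen, Tr.gen, Tr.star_of]
  refine (Fintype.sum_equiv (Fintype.equivFin α) _ _ fun a => ?_).symm
  rw [RTree.graft_relabel,
    ← Tr.gen_relabel (Equiv.sumCongr (Fintype.equivFin α) (Fintype.equivFin β)) (T.graft a S)]
  congr 1
  funext x
  rcases x with x | x <;> rfl

theorem Tr.map_gen (f : V →ₗ[k] W) (T : RTree α) (w : α → V) :
    Tr.map k f (Tr.gen k T w) = Tr.gen k T (f ∘ w) := by
  simp only [Tr.gen, Tr.of, Tr.map, DirectSum.lmap_lof, Decorated.map, Decorated.of,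
    Decorated.lift_mk, LinearMap.comp_apply, Finsupp.mapRange.linearMap_apply,
    Finsupp.mapRange_single, PiTensorProduct.map_tprod]
  rfl

theorem Tr.vertex_eq_gen (x : V) :
    Tr.vertex k x = Tr.gen k (RTree.single (Fin 1)) (fun _ => x) := by
  rw [Tr.gen_fin]
  rfl

/-! ### The pre-Lie identity -/

/-- Grafting `R` onto vertices of `S` cancels against the second product. What remains are
independent grafts of `S` and `R` onto `T`, symmetric in the two. -/
theorem Tr.associator_gen (T : RTree α) (S : RTree β) (R : RTree γ) (w : α → V) (u : β → V)
    (t : γ → V) :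
    star k V (star k V (Tr.gen k T w) (Tr.gen k S u)) (Tr.gen k R t) -
        star k V (Tr.gen k T w) (star k V (Tr.gen k S u) (Tr.gen k R t)) =
      ∑ a, ∑ b, Tr.gen k ((T.graft a S).graft (Sum.inl b) R) (Sum.elim (Sum.elim w u) t) := by
  simp only [Tr.star_gen, map_sum, LinearMap.sum_apply, Fintype.sum_sum_type,
    Finset.sum_add_distrib]
  rw [Finset.sum_comm (s := (Finset.univ : Finset β)), add_sub_assoc, add_eq_left, sub_eq_zero]
  refine Finset.sum_congr rfl fun a _ => Finset.sum_congr rfl fun b _ => ?_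
  rw [← graft_graft_inr, ← Tr.gen_relabel (Equiv.sumAssoc α β γ)]
  congr 1
  funext x
  rcases x with x | x | x <;> rfl

/-- The right pre-Lie identity. -/
theorem Tr.associator_symm (x y z : Tr k V) :
    star k V (star k V x y) z - star k V x (star k V y z) =
      star k V (star k V x z) y - star k V x (star k V z y) := by
  induction x using Tr.induction with
  | zero => simp
  | add x x' hx hx' =>
    simp only [map_add, LinearMap.add_apply, add_sub_add_comm, hx, hx']
  | smul r x hx => simp only [map_smul, LinearMap.smul_apply, ← smul_sub, hx]
  | of m T w =>
  induction y using Tr.induction with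
  | zero => simp
  | add y y' hy hy' =>
    simp only [map_add, LinearMap.add_apply, add_sub_add_comm, hy, hy']
  | smul r y hy => simp only [map_smul, LinearMap.smul_apply, ← smul_sub, hy]
  | of n S u =>
  induction z using Tr.induction with
  | zero => simp
  | add z z' hz hz' =>
    simp only [map_add, LinearMap.add_apply, add_sub_add_comm, hz, hz']
  | smul r z hz => simp only [map_smul, LinearMap.smul_apply, ← smul_sub, hz]
  | of l R t =>
    rw [← Tr.gen_fin, ← Tr.gen_fin, ← Tr.gen_fin, Tr.associator_gen, Tr.associator_gen,
      Finset.sum_comm]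
    refine Finset.sum_congr rfl fun a _ => Finset.sum_congr rfl fun b _ => ?_
    rw [← Tr.gen_relabel (sumRightComm (Fin m) (Fin n) (Fin l)), graft_graft_inl]
    congr 1
    funext x
    rcases x with (x | x) | x <;> rfl

variable (k V) in
/-- The Lie algebra of decorated trees, with the commutator of the pre-Lie product as its
bracket. -/
@[reducible] def Tr.lieRing : LieRing (Tr k V) where
  bracket x y := star k V x y - star k V y x
  add_lie x y z := by simp only [map_add, LinearMap.add_apply]; abel
  lie_add x y z := by simp only [map_add, LinearMap.add_apply]; abel
  lie_self x := sub_self _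
  leibniz_lie x y z := by
    have h1 := Tr.associator_symm x y z
    have h2 := Tr.associator_symm y x z
    have h3 := Tr.associator_symm z x y
    simp only [map_sub, LinearMap.sub_apply]
    linear_combination (norm := module) h2 - h1 - h3

attribute [local instance] Tr.lieRing

theorem Tr.lie_def (x y : Tr k V) : ⁅x, y⁆ = star k V x y - star k V y x := rfl

variable (k V) in
/-- The commutator of the pre-Lie product is bilinear. -/
@[reducible] def Tr.lieAlgebra : LieAlgebra k (Tr k V) where
  lie_smul r x y := by
    simp only [Tr.lie_def, map_smul, LinearMap.smul_apply, smul_sub]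

end Generators

/-! ### The homomorphism from the free Lie algebra to trees. -/

section FreeLieToTrees

variable (k : Type*) [CommRing k] {V W : Type*} [AddCommGroup V] [Module k V]
  [AddCommGroup W] [Module k W]

attribute [local instance] Tr.lieRing Tr.lieAlgebra

/-- The embedding of the decorations as one-vertex trees. -/
def Tr.vertexHom : V →ₗ[k] Tr k V :=
  DirectSum.lof k ℕ (fun n => Decorated k V n (RTree (Fin n))) 1 ∘ₗ
    Decorated.mk k V 1 (RTree (Fin 1)) ∘ₗ Finsupp.lsingle (RTree.single (Fin 1)) ∘ₗ
      (MultilinearMap.ofSubsingleton k V _ (0 : Fin 1)).symm (PiTensorProduct.tprod k)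

/-- The homomorphism from the free Lie algebra to the Lie algebra of decorated trees. -/
def toTrees : FreeLie k V →ₗ⁅k⁆ Tr k V := FreeLie.lift k (Tr.vertexHom k)

@[simp] theorem toTrees_of (x : V) : toTrees k (FreeLie.of k x) = Tr.vertex k x :=
  FreeLie.lift_of k (Tr.vertexHom k) x

theorem toTrees_lie (x y : FreeLie k V) : toTrees k ⁅x, y⁆ =
    star k V (toTrees k x) (toTrees k y) - star k V (toTrees k y) (toTrees k x) :=
  LieHom.map_lie (toTrees k) x y

theorem Tr.map_star (f : V →ₗ[k] W) (x y : Tr k V) :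
    Tr.map k f (star k V x y) = star k W (Tr.map k f x) (Tr.map k f y) := by
  induction x using Tr.induction with
  | zero => simp
  | add x x' hx hx' => simp only [map_add, LinearMap.add_apply, hx, hx']
  | smul r x hx => simp only [map_smul, LinearMap.smul_apply, hx]
  | of m T w =>
  induction y using Tr.induction with
  | zero => simp
  | add y y' hy hy' => simp only [map_add, hy, hy']
  | smul r y hy => simp only [map_smul, hy]
  | of n S u =>
    rw [← Tr.gen_fin, ← Tr.gen_fin, Tr.star_gen, Tr.map_gen, Tr.map_gen, Tr.star_gen, map_sum]
    refine Finset.sum_congr rfl fun a _ => ?_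
    rw [Tr.map_gen, Sum.comp_elim]

/-- The functoriality of decorated trees, as a homomorphism of Lie algebras. -/
def Tr.mapLie (f : V →ₗ[k] W) : Tr k V →ₗ⁅k⁆ Tr k W where
  toLinearMap := Tr.map k f
  map_lie' {x y} := by
    change Tr.map k f ⁅x, y⁆ = ⁅Tr.map k f x, Tr.map k f y⁆
    rw [Tr.lie_def, Tr.lie_def, map_sub, Tr.map_star, Tr.map_star]

theorem toTrees_map (f : V →ₗ[k] W) (x : FreeLie k V) :
    toTrees k (FreeLie.map k f x) = Tr.map k f (toTrees k x) := by
  have : (toTrees k).comp (FreeLie.map k f) = (Tr.mapLie k f).comp (toTrees k) := by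
    refine FreeLie.hom_ext k fun x => ?_
    change toTrees k (FreeLie.map k f (FreeLie.of k x)) = Tr.map k f (toTrees k (FreeLie.of k x))
    rw [FreeLie.map, FreeLie.lift_of, LinearMap.comp_apply, toTrees_of, toTrees_of,
      Tr.vertex_eq_gen, Tr.vertex_eq_gen x, Tr.map_gen]
    rfl
  exact LieHom.congr_fun this x

variable {k}

/-- The free Lie algebra is generated by `V` as a Lie algebra. -/
theorem FreeLie.induction {p : FreeLie k V → Prop} (zero : p 0)
    (add : ∀ x y, p x → p y → p (x + y)) (smul : ∀ (r : k) x, p x → p (r • x))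
    (lie : ∀ x y, p x → p y → p ⁅x, y⁆) (of : ∀ v, p (FreeLie.of k v)) (x : FreeLie k V) : p x := by
  let K : LieSubalgebra k (FreeLie k V) :=
    { carrier := {x | p x}
      zero_mem' := zero
      add_mem' := fun {x y} hx hy => add x y hx hy
      smul_mem' := fun r x hx => smul r x hx
      lie_mem' := fun {x y} hx hy => lie x y hx hy }
  let f : V →ₗ[k] K := LinearMap.codRestrict K.toSubmodule (FreeLie.of k) of
  have h : K.incl.comp (FreeLie.lift k f) = LieHom.id := by
    refine FreeLie.hom_ext k fun v => ?_
    rw [LieHom.comp_apply, FreeLie.lift_of]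
    rfl
  have hx := LieHom.congr_fun h x
  rw [LieHom.comp_apply] at hx
  have h2 : K.incl (FreeLie.lift k f x) ∈ K := (FreeLie.lift k f x).2
  rw [hx] at h2
  exact h2

/-- A subspace of a Lie algebra containing the image of `V` and stable under bracketing with this
image contains the image of the free Lie algebra. -/
theorem FreeLie.map_mem_of_lie_mem {L : Type*} [LieRing L] [LieAlgebra k L]
    (F : FreeLie k V →ₗ⁅k⁆ L) (A : Submodule k L) (h : ∀ v, F (FreeLie.of k v) ∈ A)
    (h' : ∀ a ∈ A, ∀ v, ⁅a, F (FreeLie.of k v)⁆ ∈ A) (x : FreeLie k V) : F x ∈ A := by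
  -- Stability under the generators extends to all of the image through the Jacobi identity `⁅a, ⁅x,
  -- y⁆⁆ = ⁅⁅a, x⁆, y⁆ - ⁅⁅a, y⁆, x⁆`.
  have key : ∀ y : FreeLie k V, ∀ a ∈ A, ⁅a, F y⁆ ∈ A := by
    intro y
    induction y using FreeLie.induction with
    | zero => intro a _; simp
    | add x y hx hy =>
      intro a ha
      rw [map_add, lie_add]
      exact A.add_mem (hx a ha) (hy a ha)
    | smul r x hx =>
      intro a ha
      rw [map_smul, lie_smul]
      exact A.smul_mem r (hx a ha)
    | lie x y hx hy =>
      intro a ha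
      rw [LieHom.map_lie, leibniz_lie, ← lie_skew (F x) ⁅a, F y⁆, ← sub_eq_add_neg]
      exact A.sub_mem (hy _ (hx a ha)) (hx _ (hy a ha))
    | of v => exact fun a ha => h' a ha v
  induction x using FreeLie.induction with
  | zero => simp
  | add x y hx hy => rw [map_add]; exact A.add_mem hx hy
  | smul r x hx => rw [map_smul]; exact A.smul_mem r hx
  | lie x y hx hy => rw [LieHom.map_lie]; exact key y _ hx
  | of v => exact h v

/-! ### Expansion of iterated brackets -/

section BracketSum

variable {α β : Type*} [Fintype α] [Fintype β]

variable (k) in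
/-- The left normed bracket of the vertices `w`, ordered by their rank. -/
def bracketSum (ρ : α → ℕ) (w : α → V) : Tr k V :=
  ∑ T : RTree α, RTree.bracketCoeff ρ T • Tr.gen k T w

theorem bracketSum_comp (e : α ≃ β) (ρ : β → ℕ) (w : β → V) :
    bracketSum k (ρ ∘ e) (w ∘ e) = bracketSum k ρ w := by
  refine Fintype.sum_equiv (RTree.relabelEquiv e) _ _ fun T => ?_
  change _ = RTree.bracketCoeff ρ (T.relabel e) • Tr.gen k (T.relabel e) w
  rw [RTree.bracketCoeff_relabel, ← Tr.gen_relabel e]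
  congr 2
  funext x
  simp

theorem gen_unique [Unique α] (T : RTree α) (w : α → V) :
    Tr.gen k T w = Tr.vertex k (w default) := by
  rw [Tr.vertex_eq_gen, ← Tr.gen_relabel (Equiv.ofUnique α (Fin 1))]
  congr 1
  refine RTree.ext_of_parent (funext fun x => Subsingleton.elim _ _)

theorem bracketSum_unique [Unique α] (ρ : α → ℕ) (w : α → V) :
    bracketSum k ρ w = Tr.vertex k (w default) := by
  have hu : ∀ T : RTree α, T = RTree.single α := fun T =>
    RTree.ext_of_parent (funext fun x => Subsingleton.elim _ _)
  rw [bracketSum, Fintype.sum_eq_single (RTree.single α) fun T hT => absurd (hu T) hT, gen_unique,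
    RTree.bracketCoeff_of_increasing]
  · rw [Finset.prod_eq_one, one_smul]
    intro i _
    exact if_neg (lt_irrefl _)
  · intro i j j' _ _ _ _
    exact Subsingleton.elim _ _

/-- Multiplying by a vertex on the right attaches it as a leaf in all possible ways, and multiplying
on the left makes it the new root. Their difference is the recursion for `bracketCoeff`, so
`bracketSum` is indeed an iterated bracket. -/
theorem lie_bracketSum [Nonempty α] {ρ : Option α → ℕ} (hρ : ∀ x, ρ (some x) < ρ none)
    (w : Option α → V) :
    ⁅bracketSum k (ρ ∘ some) (w ∘ some), Tr.vertex k (w none)⁆ = bracketSum k ρ w := by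
  rw [bracketSum, bracketSum, RTree.sum_bracketCoeff_option hρ, Tr.lie_def, map_sum,
    LinearMap.sum_apply, map_sum, ← Finset.sum_sub_distrib]
  refine Finset.sum_congr rfl fun T _ => ?_
  rw [map_zsmul, map_zsmul, LinearMap.smul_apply, ← smul_sub, Tr.vertex_eq_gen, Tr.star_gen,
    Tr.star_gen]
  have h1 : ∀ a, Tr.gen k (T.addLeaf a) w =
      Tr.gen k (T.graft a (RTree.single (Fin 1))) (Sum.elim (w ∘ some) fun _ => w none) := by
    intro a
    rw [← Tr.gen_relabel (RTree.sumOneEquiv α)]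
    congr 1
    funext x
    rcases x with _ | x <;> rfl
  have h2 : Tr.gen k T.addRoot w =
      Tr.gen k ((RTree.single (Fin 1)).graft 0 T) (Sum.elim (fun _ => w none) (w ∘ some)) := by
    rw [← Tr.gen_relabel ((Equiv.sumComm _ _).trans (RTree.sumOneEquiv α))]
    congr 1
    funext x
    rcases x with _ | x <;> rfl
  simp only [h1, h2, Finset.univ_unique, Finset.sum_singleton]
  rfl

/-- The vertex of largest rank is the last entry of the bracket; removing it gives an induction on
the number of vertices. -/
theorem bracketSum_mem_range [Nonempty α] {ρ : α → ℕ} (hρ : Function.Injective ρ) (w : α → V) :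
    bracketSum k ρ w ∈ LinearMap.range (toTrees k (V := V)).toLinearMap := by
  classical
  induction hn : Fintype.card α generalizing α with
  | zero => exact absurd hn Fintype.card_ne_zero
  | succ n ih =>
    obtain ⟨a, -, ha⟩ := Finset.univ.exists_max_image ρ Finset.univ_nonempty
    by_cases hne : Nonempty {x // x ≠ a}
    · rw [← bracketSum_comp (Equiv.optionSubtypeNe a), ← lie_bracketSum]
      · have hmem := ih (α := {x // x ≠ a}) (ρ := (ρ ∘ Equiv.optionSubtypeNe a) ∘ some)
          ((hρ.comp (Equiv.injective _)).comp (Option.some_injective _))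
          ((w ∘ Equiv.optionSubtypeNe a) ∘ some) (by simp [hn])
        obtain ⟨y, hy⟩ := hmem
        refine ⟨⁅y, FreeLie.of k (w a)⁆, ?_⟩
        rw [LieHom.coe_toLinearMap] at hy ⊢
        rw [LieHom.map_lie, hy, toTrees_of]
        simp
      · rintro ⟨x, hx⟩
        simp only [Function.comp_apply, Equiv.optionSubtypeNe_some, Equiv.optionSubtypeNe_none]
        exact lt_of_le_of_ne (ha x (Finset.mem_univ _)) fun h => hx (hρ h)
    · have hu : ∀ x, x = a := fun x => by
        by_contra h
        exact hne ⟨⟨x, h⟩⟩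
      let _ : Unique α := ⟨⟨a⟩, hu⟩
      rw [bracketSum_unique]
      exact ⟨FreeLie.of k (w default), toTrees_of k _⟩

end BracketSum

/-- The image of the free Lie algebra is spanned by the expansions of iterated brackets. -/
theorem toTrees_mem_span (x : FreeLie k V) :
    toTrees k x ∈ Submodule.span k {z | ∃ (n : ℕ) (ρ : Fin n → ℕ) (w : Fin n → V),
      Function.Injective ρ ∧ z = bracketSum k ρ w} := by
  have hcomp : ∀ {α : Type} [Fintype α] [Nonempty α] (ρ : α → ℕ) (w : α → V),
      Function.Injective ρ → bracketSum k ρ w ∈ {z | ∃ (n : ℕ) (ρ : Fin n → ℕ) (w : Fin n → V),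
        Function.Injective ρ ∧ z = bracketSum k ρ w} := by
    intro α _ _ ρ w hρ
    exact ⟨Fintype.card α, ρ ∘ (Fintype.equivFin α).symm, w ∘ (Fintype.equivFin α).symm,
      hρ.comp (Equiv.injective _), (bracketSum_comp _ _ _).symm⟩
  refine FreeLie.map_mem_of_lie_mem (toTrees k) _ (fun v => ?_) (fun a ha v => ?_) x
  · refine Submodule.subset_span ?_
    rw [toTrees_of, ← bracketSum_unique (α := Fin 1) (fun _ => 0) fun _ => v]
    exact hcomp _ _ (Function.injective_of_subsingleton _)
  · rw [toTrees_of]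
    induction ha using Submodule.span_induction with
    | zero => simp
    | add a b _ _ ha hb => rw [add_lie]; exact Submodule.add_mem _ ha hb
    | smul r a _ ha => rw [smul_lie]; exact Submodule.smul_mem _ r ha
    | mem a ha =>
      obtain ⟨n, ρ, w, hρ, rfl⟩ := ha
      rcases isEmpty_or_nonempty (Fin n) with hn | hn
      · have : bracketSum k ρ w = 0 := Finset.sum_eq_zero fun T _ => isEmptyElim T.root
        rw [this, zero_lie]
        exact Submodule.zero_mem _
      · refine Submodule.subset_span ?_
        -- The sum of all ranks plus one exceeds every rank, so the new entry comes last.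
        let ρ' : Option (Fin n) → ℕ := fun o => o.elim (∑ i, ρ i + 1) ρ
        have hlt : ∀ i, ρ' (some i) < ρ' none := fun i =>
          Nat.lt_succ_of_le (Finset.single_le_sum (fun _ _ => Nat.zero_le _) (Finset.mem_univ i))
        have hinj : Function.Injective ρ' := by
          rintro (_ | i) (_ | j) h
          · rfl
          · exact absurd h (hlt j).ne'
          · exact absurd h (hlt i).ne
          · exact congrArg some (hρ h)
        have := lie_bracketSum (k := k) hlt fun o => o.elim v w
        change ⁅bracketSum k ρ w, Tr.vertex k v⁆ = _ at this
        rw [this]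
        exact hcomp _ _ hinj

end FreeLieToTrees

/-! ### The kernel of `δ` and balanced functions -/

section Delta

variable {k : Type*} [CommRing k] {V : Type*} [AddCommGroup V] [Module k V] {n : ℕ}

theorem zsmul_single_apply {X M : Type*} [AddCommGroup M] [DecidableEq X] (c : ℤ) (x y : X) (t : M) :
    (c • Finsupp.single x t) y = if x = y then c • t else 0 := by
  rw [← Finsupp.single_apply, ← Finsupp.singleAddHom_apply, ← Finsupp.singleAddHom_apply, map_zsmul]

open Classical in
theorem deltaTensor_apply (f : SpanTensor k V n (RTree (Fin n))) (S : RTree (Option (Fin n))) :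
    deltaTensor k V n f S =
      ∑ x, ∑ T : RTree (Fin n), if (S, x) ∈ T.blowUps then RTree.sign (S, x) • f T else 0 := by
  conv_lhs => rw [← Finsupp.univ_sum_single f]
  rw [map_sum, Finsupp.finsetSum_apply, Finset.sum_comm]
  refine Finset.sum_congr rfl fun T _ => ?_
  rw [deltaTensor_single, Finsupp.finsetSum_apply, Finset.sum_filter, Fintype.sum_prod_type,
    Fintype.sum_eq_single S]
  · refine Finset.sum_congr rfl fun x _ => ?_
    rw [zsmul_single_apply, if_pos rfl]
  · intro S' hS'
    refine Finset.sum_eq_zero fun x _ => ?_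
    rw [zsmul_single_apply, if_neg hS', ite_self]

/-- The blow-ups are grouped by the tree `S` instead of by `T`. The coefficient of `S` is then one
signed sum over its special edges, or zero if its special vertex has arity less than two. -/
theorem deltaTensor_eq_zero_iff (f : SpanTensor k V n (RTree (Fin n))) :
    deltaTensor k V n f = 0 ↔ RTree.IsBalanced f := by
  classical
  have key : ∀ S : RTree (Option (Fin n)), deltaTensor k V n f S =
      if 2 ≤ S.arity none then
        ∑ x : {x // RTree.IsSpecialEdge S x}, RTree.sign (S, x.1) • f (S.contract x) else 0 := by
    intro S
    rw [deltaTensor_apply]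
    split_ifs with hS
    · have hmem : ∀ x, x ∈ Finset.univ.filter (RTree.IsSpecialEdge S) ↔ RTree.IsSpecialEdge S x :=
        fun x => Finset.mem_filter_univ x
      rw [← Finset.sum_filter_of_ne (p := RTree.IsSpecialEdge S), Finset.sum_subtype _ hmem]
      · refine Finset.sum_congr rfl fun x _ => ?_
        rw [Fintype.sum_eq_single (S.contract x), if_pos]
        · exact ⟨x.2, (RTree.isContraction_iff S x _).2 rfl, hS⟩
        · intro T hT
          exact if_neg fun h => hT ((RTree.isContraction_iff S x T).1 h.2.1)
      · intro x _ hx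
        by_contra h
        exact hx (Finset.sum_eq_zero fun T _ => if_neg fun h' => h h'.1)
    · refine Finset.sum_eq_zero fun x _ => Finset.sum_eq_zero fun T _ => if_neg ?_
      exact fun h => hS h.2.2
  constructor
  · intro h S hS
    have := key S
    rw [h, if_pos hS] at this
    exact this.symm
  · intro h
    ext1 S
    rw [key]
    split_ifs with hS
    · exact h S hS
    · rfl

theorem delta_lof (f : SpanTensor k V n (RTree (Fin n))) :
    delta k V (DirectSum.lof k ℕ (fun n => Decorated k V n (RTree (Fin n))) n
      (Decorated.mk k V n _ f)) =
    DirectSum.lof k ℕ (fun n => Decorated k V n (RTree (Option (Fin n)))) n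
      (Decorated.mk k V n _ (deltaTensor k V n f)) := by
  rw [delta, DirectSum.lmap_lof, Decorated.lift_mk, LinearMap.comp_apply]

variable (k V) in
/-- The function with values `c T • t`. -/
def smulTensor (c : RTree (Fin n) → ℤ) :
    (⨂[k] _ : Fin n, V) →ₗ[k] SpanTensor k V n (RTree (Fin n)) :=
  ∑ T, c T • Finsupp.lsingle T

theorem smulTensor_eq_sum (c : RTree (Fin n) → ℤ) (t : ⨂[k] _ : Fin n, V) :
    smulTensor k V c t = ∑ T, c T • Finsupp.single T t := by
  rw [smulTensor, LinearMap.sum_apply]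
  rfl

theorem smulTensor_apply (c : RTree (Fin n) → ℤ) (t : ⨂[k] _ : Fin n, V) (T : RTree (Fin n)) :
    smulTensor k V c t T = c T • t := by
  classical
  rw [smulTensor_eq_sum, Finsupp.finsetSum_apply, Fintype.sum_eq_single T]
  · rw [zsmul_single_apply, if_pos rfl]
  · intro T' hT'
    rw [zsmul_single_apply, if_neg hT']

theorem lof_smulTensor (ρ : Fin n → ℕ) (w : Fin n → V) :
    DirectSum.lof k ℕ (fun n => Decorated k V n (RTree (Fin n))) n (Decorated.mk k V n _
      (smulTensor k V (RTree.bracketCoeff ρ) (PiTensorProduct.tprod k w))) = bracketSum k ρ w := by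
  rw [smulTensor_eq_sum, map_sum, map_sum, bracketSum]
  refine Finset.sum_congr rfl fun T _ => ?_
  rw [map_zsmul, map_zsmul, Tr.gen_fin]
  rfl

theorem deltaTensor_smulTensor {ρ : Fin n → ℕ} (hρ : Function.Injective ρ) (t : ⨂[k] _ : Fin n, V) :
    deltaTensor k V n (smulTensor k V (RTree.bracketCoeff ρ) t) = 0 := by
  rw [deltaTensor_eq_zero_iff]
  have : ⇑(smulTensor k V (RTree.bracketCoeff ρ) t) = fun T => RTree.bracketCoeff ρ T • t :=
    funext fun T => smulTensor_apply _ t T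
  rw [this]
  exact RTree.isBalanced_bracketCoeff hρ t

attribute [local instance] Tr.lieRing Tr.lieAlgebra

theorem delta_toTrees (x : FreeLie k V) : delta k V (toTrees k x) = 0 := by
  refine LinearMap.mem_ker.1 (Submodule.span_le.2 ?_ (toTrees_mem_span x))
  rintro _ ⟨n, ρ, w, hρ, rfl⟩
  change delta k V _ = 0
  rw [← lof_smulTensor, delta_lof, deltaTensor_smulTensor hρ, map_zero, map_zero]

theorem lof_smulTensor_mem_range [Nonempty (Fin n)] {ρ : Fin n → ℕ} (hρ : Function.Injective ρ)
    (t : ⨂[k] _ : Fin n, V) :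
    DirectSum.lof k ℕ (fun n => Decorated k V n (RTree (Fin n))) n (Decorated.mk k V n _
      (smulTensor k V (RTree.bracketCoeff ρ) t)) ∈
        LinearMap.range (toTrees k (V := V)).toLinearMap := by
  induction t using PiTensorProduct.induction_on with
  | add a b ha hb =>
    rw [map_add, map_add, map_add]
    exact Submodule.add_mem _ ha hb
  | smul_tprod r w =>
    rw [map_smul, map_smul, map_smul, lof_smulTensor]
    exact Submodule.smul_mem _ r (bracketSum_mem_range hρ w)

/-- A balanced function is a combination of the coefficients of iterated brackets. -/
theorem eq_sum_smulTensor (z : Fin n) (f : SpanTensor k V n (RTree (Fin n)))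
    (hf : deltaTensor k V n f = 0) [DecidablePred fun T : RTree (Fin n) => T.root = z ∧ T.IsLadder] :
    f = ∑ T : RTree (Fin n) with T.root = z ∧ T.IsLadder,
      smulTensor k V (RTree.bracketCoeff T.depth) (f T) := by
  classical
  rw [← sub_eq_zero]
  have hg : deltaTensor k V n (f - ∑ T : RTree (Fin n) with T.root = z ∧ T.IsLadder,
      smulTensor k V (RTree.bracketCoeff T.depth) (f T)) = 0 := by
    rw [map_sub, hf, map_sum, zero_sub, neg_eq_zero]
    refine Finset.sum_eq_zero fun T hT => ?_
    rw [Finset.mem_filter_univ] at hT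
    exact deltaTensor_smulTensor hT.2.depth_injective _
  rw [deltaTensor_eq_zero_iff] at hg
  ext1 L
  -- The difference is balanced, and by duality it vanishes on all ladders with root `z`.
  refine hg.eq_zero z (fun L hL hl => ?_) L
  rw [Finsupp.sub_apply, Finsupp.finsetSum_apply, Finset.sum_eq_single L, smulTensor_apply,
    RTree.bracketCoeff_depth_self, one_smul, sub_self]
  · intro T hT hne
    rw [Finset.mem_filter_univ] at hT
    rw [smulTensor_apply, RTree.bracketCoeff_depth_of_ne hT.2 hl (hL.trans hT.1.symm) hne.symm,
      zero_smul]
  · intro h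
    exact absurd ((Finset.mem_filter_univ _).2 ⟨hL, hl⟩) h

/-! ### Symmetrization -/

section Symmetrize

variable {X : Type*} [MulAction (Equiv.Perm (Fin n)) X]

theorem diag_mul (σ τ : Equiv.Perm (Fin n)) (z : SpanTensor k V n X) :
    diag k V n X (σ * τ) z = diag k V n X σ (diag k V n X τ z) := by
  induction z using Finsupp.induction_linear with
  | zero => simp
  | add a b ha hb => rw [map_add, map_add, map_add, ha, hb]
  | single x t => rw [diag_single, diag_single, diag_single, mul_smul, map_mul]; rfl

variable (k V n X) in
/-- The symmetrization of coinvariants. -/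
def symmetrize : Decorated k V n X →ₗ[k] SpanTensor k V n X :=
  Decorated.lift (∑ σ, diag k V n X σ) (by
    intro τ z
    rw [LinearMap.sum_apply, LinearMap.sum_apply]
    refine Fintype.sum_equiv (Equiv.mulRight τ) _ _ fun σ => ?_
    rw [← diag_mul]
    rfl)

theorem symmetrize_mk (z : SpanTensor k V n X) :
    symmetrize k V n X (Decorated.mk k V n X z) = ∑ σ, diag k V n X σ z := by
  rw [symmetrize, Decorated.lift_mk, LinearMap.sum_apply]

/-- In characteristic zero `n!` is invertible, so each class can be represented by a symmetric
tensor. -/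
theorem mk_symmetrize (x : Decorated k V n X) :
    Decorated.mk k V n X (symmetrize k V n X x) = (n.factorial : k) • x := by
  obtain ⟨z, rfl⟩ := Decorated.mk_surjective k V n X x
  rw [symmetrize_mk, map_sum, Finset.sum_congr rfl fun σ _ => Decorated.mk_diag k V n X σ z,
    Finset.sum_const, Finset.card_univ, Fintype.card_perm, Fintype.card_fin, Nat.cast_smul_eq_nsmul]

end Symmetrize

/-- The hypothesis only says that δ vanishes modulo the symmetric group. As δ is equivariant,
symmetrizing yields a tensor on which it vanishes exactly, so that the analysis of balanced
functions applies. -/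
theorem deltaTensor_symmetrize {x : Decorated k V n (RTree (Fin n))}
    (hx : delta k V (DirectSum.lof k ℕ (fun n => Decorated k V n (RTree (Fin n))) n x) = 0) :
    deltaTensor k V n (symmetrize k V n _ x) = 0 := by
  obtain ⟨z, rfl⟩ := Decorated.mk_surjective k V n _ x
  rw [delta_lof, ← map_zero (DirectSum.lof k ℕ (fun n => Decorated k V n (RTree (Option (Fin n)))) n)]
    at hx
  have h := DirectSum.of_injective n hx
  rw [symmetrize_mk, map_sum, Finset.sum_congr rfl fun σ _ => deltaTensor_diag k V σ z,
    ← symmetrize_mk, h, map_zero]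

end Delta

/-! ### The kernel of δ is contained in the image of the free Lie algebra. -/

section Surjectivity

variable {k : Type*} [Field k] [CharZero k] {V : Type*} [AddCommGroup V] [Module k V]

attribute [local instance] Tr.lieRing Tr.lieAlgebra

/-- The symmetrization of `x` is a combination of bracket expansions, and its class is `n!` times
`x`; dividing by `n!` gives the claim. -/
theorem lof_mem_range {n : ℕ} {x : Decorated k V n (RTree (Fin n))}
    (hx : delta k V (DirectSum.lof k ℕ (fun n => Decorated k V n (RTree (Fin n))) n x) = 0) :
    DirectSum.lof k ℕ (fun n => Decorated k V n (RTree (Fin n))) n x ∈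
      LinearMap.range (toTrees k (V := V)).toLinearMap := by
  classical
  rcases isEmpty_or_nonempty (Fin n) with hn | ⟨⟨z⟩⟩
  · obtain ⟨z, rfl⟩ := Decorated.mk_surjective k V n _ x
    have : z = 0 := by
      ext1 T
      exact isEmptyElim T.root
    rw [this, map_zero, map_zero]
    exact Submodule.zero_mem _
  · have : Nonempty (Fin n) := ⟨z⟩
    have h := mk_symmetrize x
    rw [eq_sum_smulTensor z _ (deltaTensor_symmetrize hx), map_sum] at h
    have hfac : (n.factorial : k) ≠ 0 := Nat.cast_ne_zero.2 n.factorial_ne_zero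
    rw [← Submodule.smul_mem_iff _ hfac, ← map_smul, ← h, map_sum]
    refine Submodule.sum_mem _ fun T hT => ?_
    rw [Finset.mem_filter_univ] at hT
    exact lof_smulTensor_mem_range hT.2.depth_injective _

theorem mem_range_of_delta_eq_zero {x : Tr k V} (hx : delta k V x = 0) :
    x ∈ LinearMap.range (toTrees k (V := V)).toLinearMap := by
  classical
  rw [← DirectSum.sum_support_of x]
  refine Submodule.sum_mem _ fun n _ => lof_mem_range ?_
  rw [delta, DirectSum.lmap_lof]
  have := DFunLike.congr_fun hx n
  rw [delta, DirectSum.lmap_apply] at this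
  rw [this]
  exact map_zero _

end Surjectivity

/-! ### A left inverse up to scalars -/

namespace RTree

/-- The ladder in which the parent of every vertex is the preceding one. -/
def IsStandard {n : ℕ} (T : RTree (Fin n)) : Prop := ∀ i, (T.parent i : ℕ) = (i : ℕ) - 1

theorem isStandard_relabel {α : Type*} {n : ℕ} {T : RTree α} {e : α ≃ Fin n} :
    (T.relabel e).IsStandard ↔ ∀ x, (e (T.parent x) : ℕ) = (e x : ℕ) - 1 := by
  constructor
  · intro h x
    have := h (e x)
    rwa [relabel_parent, e.symm_apply_apply] at this
  · intro h i
    have := h (e.symm i)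
    rwa [e.apply_symm_apply] at this

/-- The extension of a numbering by a last element. -/
def extendLast {α : Type*} {n : ℕ} (e : α ≃ Fin n) : Option α ≃ Fin (n + 1) :=
  (Equiv.optionCongr e).trans finSuccEquivLast.symm

@[simp] theorem extendLast_some {α : Type*} {n : ℕ} (e : α ≃ Fin n) (x : α) :
    extendLast e (some x) = (e x).castSucc := by
  simp [extendLast]

@[simp] theorem extendLast_none {α : Type*} {n : ℕ} (e : α ≃ Fin n) :
    extendLast e none = Fin.last n := by
  simp [extendLast]

@[simp] theorem extendLast_symm_castSucc {α : Type*} {n : ℕ} (e : α ≃ Fin n) (i : Fin n) :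
    (extendLast e).symm i.castSucc = some (e.symm i) := by
  rw [Equiv.symm_apply_eq, extendLast_some, e.apply_symm_apply]

@[simp] theorem extendLast_symm_last {α : Type*} {n : ℕ} (e : α ≃ Fin n) :
    (extendLast e).symm (Fin.last n) = none := by
  rw [Equiv.symm_apply_eq, extendLast_none]

/-- With `eq_extendLast_of_isStandard`: adding a leaf yields a ladder only if the leaf is put on the
top vertex of a ladder, and its number is then the last one. -/
theorem isStandard_addLeaf {α : Type*} {m : ℕ} (T : RTree α) (e : α ≃ Fin (m + 1)) :
    ((T.addLeaf (e.symm (Fin.last m))).relabel (extendLast e)).IsStandard ↔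
      (T.relabel e).IsStandard := by
  rw [isStandard_relabel, isStandard_relabel]
  constructor
  · intro h x
    simpa using h (some x)
  · rintro h (_ | x)
    · simp
    · simpa using h x

theorem eq_extendLast_of_isStandard {α : Type*} {m : ℕ} {T : RTree α} {a : α}
    {e : Option α ≃ Fin (m + 2)} (h : ((T.addLeaf a).relabel e).IsStandard) :
    ∃ e' : α ≃ Fin (m + 1), e = extendLast e' ∧ a = e'.symm (Fin.last m) := by
  rw [isStandard_relabel] at h
  have hlast : e none = Fin.last (m + 1) := by
    by_contra hne
    have hlt : (e none : ℕ) < m + 1 := Fin.val_lt_last hne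
    -- If the new leaf were not last, the vertex with the next number would be its child.
    obtain ⟨o, ho⟩ := e.surjective ⟨e none + 1, by omega⟩
    have h1 := h o
    rw [ho] at h1
    have h2 : (T.addLeaf a).parent o = none := e.injective (Fin.ext (by simpa using h1))
    cases o <;> simp at h2
  let f : Option α ≃ Option (Fin (m + 1)) := e.trans finSuccEquivLast
  have hf : f none = none := by simp [f, hlast]
  have hext : e = extendLast f.removeNone := by
    refine Equiv.ext ?_
    rintro (_ | x)
    · rw [hlast, extendLast_none]
    · have : ∃ y, f (some x) = some y := by
        rcases hx : f (some x) with _ | y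
        · exact absurd (f.injective (hx.trans hf.symm)) (by simp)
        · exact ⟨y, rfl⟩
      have h1 := Equiv.removeNone_some f this
      apply finSuccEquivLast.injective
      rw [extendLast_some, finSuccEquivLast_castSucc, h1]
      rfl
  refine ⟨f.removeNone, hext, ?_⟩
  have h1 := h none
  rw [hext, addLeaf_parent_none, extendLast_some, extendLast_none] at h1
  rw [Equiv.eq_symm_apply]
  exact Fin.ext (by simpa using h1)

end RTree

section Retraction

variable (k : Type*) [CommRing k] (V : Type*) [AddCommGroup V] [Module k V]

/-- The bracket with the elements of `V`. -/
def bracketRight : FreeLie k V →ₗ[k] V →ₗ[k] FreeLie k V :=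
  LinearMap.mk₂ k (fun x v => ⁅x, FreeLie.of k v⁆)
    (fun x y v => add_lie x y _) (fun r x v => smul_lie r x _)
    (fun x v w => by rw [map_add, lie_add]) fun r x v => by rw [map_smul, lie_smul]

/-- The left normed bracket of a finite sequence of vectors. -/
def leftBracket : (n : ℕ) → MultilinearMap k (fun _ : Fin n => V) (FreeLie k V)
  -- The value in degree zero is immaterial, as there are no trees without vertices.
  | 0 => 0
  | 1 => MultilinearMap.ofSubsingleton k V _ (0 : Fin 1) (FreeLie.of k)
  | n + 2 => ((bracketRight k V).compMultilinearMap (leftBracket (n + 1))).uncurryRight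

variable {k V} in
theorem leftBracket_succ (n : ℕ) (w : Fin (n + 2) → V) :
    leftBracket k V (n + 2) w =
      ⁅leftBracket k V (n + 1) fun i => w i.castSucc, FreeLie.of k (w (Fin.last (n + 1)))⁆ := by
  rw [leftBracket]
  rfl

open Classical in
/-- The map which sends a decorated ladder to the left normed bracket of the decorations, and all
other trees to zero. -/
def ofTrees : Tr k V →ₗ[k] FreeLie k V :=
  DirectSum.toModule k ℕ _ fun n => PiTensorProduct.lift (leftBracket k V n) ∘ₗ
    (∑ T : RTree (Fin n) with T.IsStandard, Finsupp.lapply T) ∘ₗ symmetrize k V n (RTree (Fin n))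

variable {k V}

-- The sum over numberings comes from the symmetrization. A ladder has a unique standard numbering,
-- so it is counted once and no factorial appears.
open Classical in
theorem ofTrees_of {n : ℕ} (T : RTree (Fin n)) (w : Fin n → V) :
    ofTrees k V (Tr.of k T w) = ∑ e : Fin n ≃ Fin n,
      if (T.relabel e).IsStandard then leftBracket k V n (w ∘ e.symm) else 0 := by
  rw [ofTrees, Tr.of, DirectSum.toModule_lof, LinearMap.comp_apply, LinearMap.comp_apply,
    Decorated.of, symmetrize_mk, map_sum, map_sum]
  refine Finset.sum_congr rfl fun e _ => ?_
  rw [diag_single, permTensor_tprod, LinearMap.sum_apply, RTree.smul_def]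
  simp only [Finsupp.lapply_apply, Finsupp.single_apply]
  rw [Finset.sum_ite_eq]
  simp only [Finset.mem_filter_univ]
  split_ifs
  · rw [PiTensorProduct.lift.tprod]
    rfl
  · rw [map_zero]

open Classical in
theorem ofTrees_gen {α : Type*} [Fintype α] [DecidableEq α] {n : ℕ} (hn : Fintype.card α = n) (T : RTree α)
    (w : α → V) : ofTrees k V (Tr.gen k T w) = ∑ e : α ≃ Fin n,
      if (T.relabel e).IsStandard then leftBracket k V n (w ∘ e.symm) else 0 := by
  have e₀ : α ≃ Fin n := Fintype.equivFinOfCardEq hn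
  rw [Tr.gen_eq_of e₀, ofTrees_of]
  refine Fintype.sum_equiv (Equiv.equivCongr e₀.symm (Equiv.refl _)) _ _ fun e => ?_
  rw [RTree.relabel_relabel]
  rfl

theorem ofTrees_vertex (v : V) : ofTrees k V (Tr.vertex k v) = FreeLie.of k v := by
  classical
  rw [Tr.vertex, ofTrees_of, Fintype.sum_unique, if_pos]
  · rfl
  · intro i
    have := i.2
    simp [RTree.single]

/-- Among the grafts of a vertex onto `T`, the only possible ladder arises by extending a ladder at
its top, which appends `v` to the left normed bracket. -/
theorem ofTrees_star_vertex (x : Tr k V) (v : V) :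
    ofTrees k V (star k V x (Tr.vertex k v)) = ⁅ofTrees k V x, FreeLie.of k v⁆ := by
  classical
  induction x using Tr.induction with
  | zero => simp
  | add x y hx hy => simp only [map_add, LinearMap.add_apply, hx, hy, add_lie]
  | smul r x hx => simp only [map_smul, LinearMap.smul_apply, hx, smul_lie]
  | of n T w =>
    obtain ⟨m, rfl⟩ : ∃ m, n = m + 1 := by
      have := T.root.2
      exact ⟨n - 1, by omega⟩
    have h1 : ∀ a, Tr.gen k (T.graft a (RTree.single (Fin 1))) (Sum.elim w fun _ => v) =
        Tr.gen k (T.addLeaf a) (fun o => o.elim v w) := by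
      intro a
      rw [← Tr.gen_relabel (RTree.sumOneEquiv _) (T.graft a (RTree.single (Fin 1)))]
      congr 1
      funext x
      rcases x with _ | x <;> rfl
    have h2 : ∀ a, ofTrees k V (Tr.gen k (T.addLeaf a) (fun o => o.elim v w)) = _ := fun a =>
      ofTrees_gen (n := m + 2) (by simp) (T.addLeaf a) fun o => o.elim v w
    rw [Tr.vertex_eq_gen, ← Tr.gen_fin, Tr.star_gen, map_sum]
    simp only [h1, h2]
    rw [← Fintype.sum_prod_type', ofTrees_gen (n := m + 1) (by simp), sum_lie]
    symm
    -- A numbering of `T` is matched with its extension and with the vertex it puts on top; all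
    -- other pairs contribute zero.
    refine Finset.sum_of_injOn
      (fun e => (e.symm (Fin.last m), RTree.extendLast e)) ?_ (fun _ _ => Finset.mem_univ _) ?_ ?_
    · intro e _ e' _ h
      refine Equiv.ext fun x => Fin.castSucc_injective _ ?_
      have := congrArg (fun p => p.2 (some x)) h
      simpa using this
    · rintro ⟨a, e⟩ _ hae
      refine if_neg fun h => hae ?_
      obtain ⟨e', rfl, rfl⟩ := RTree.eq_extendLast_of_isStandard h
      exact ⟨e', by simp, rfl⟩
    · intro e _
      simp only [RTree.isStandard_addLeaf]
      split_ifs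
      · rw [leftBracket_succ]
        simp
        rfl
      · rw [zero_lie]

attribute [local instance] Tr.lieRing Tr.lieAlgebra

/-- By the pre-Lie identity, right multiplication by `toTrees k y` is a right action of the free Lie
algebra on trees. Thus `ofTrees` intertwines it with the adjoint action as soon as it does so for
the generators. -/
theorem ofTrees_star (y : FreeLie k V) (x : Tr k V) :
    ofTrees k V (star k V x (toTrees k y)) = ⁅ofTrees k V x, y⁆ := by
  induction y using FreeLie.induction generalizing x with
  | zero => simp
  | add y z hy hz => simp only [map_add, hy, hz, lie_add]
  | smul r y hy => simp only [map_smul, hy, lie_smul]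
  | of v => rw [toTrees_of, ofTrees_star_vertex]
  | lie y z hy hz =>
    have h := Tr.associator_symm x (toTrees k y) (toTrees k z)
    have h' : star k V x (toTrees k ⁅y, z⁆) =
        star k V (star k V x (toTrees k y)) (toTrees k z) -
          star k V (star k V x (toTrees k z)) (toTrees k y) := by
      rw [toTrees_lie, map_sub]
      rw [sub_eq_sub_iff_add_eq_add] at h ⊢
      rw [add_comm, ← h, add_comm]
    rw [h', map_sub, hz, hy, hy, hz, leibniz_lie, ← lie_skew y]
    abel

/-- The composition is a derivation. -/
theorem ofTrees_toTrees_lie (x y : FreeLie k V) :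
    ofTrees k V (toTrees k ⁅x, y⁆) =
      ⁅ofTrees k V (toTrees k x), y⁆ + ⁅x, ofTrees k V (toTrees k y)⁆ := by
  rw [toTrees_lie, map_sub, ofTrees_star, ofTrees_star, ← lie_skew x, sub_eq_add_neg]

end Retraction

/-! ### Injectivity in characteristic zero and the resulting isomorphism. -/

section Injectivity

variable {k : Type*} [Field k] [CharZero k] {V : Type*} [AddCommGroup V] [Module k V]

/-- In characteristic zero, the derivation of the free Lie algebra which multiplies the elements of
degree `n` with `n` is injective. -/
theorem FreeLie.injective_of_derivation (D : FreeLie k V →ₗ[k] FreeLie k V)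
    (hD : ∀ x y, D ⁅x, y⁆ = ⁅D x, y⁆ + ⁅x, D y⁆) (hof : ∀ v, D (FreeLie.of k v) = FreeLie.of k v) :
    Function.Injective D := by
  -- The eigenspaces of positive integer eigenvalues span, since brackets add eigenvalues; the shift
  -- by one keeps zero out of the list.
  have htop : ∀ x, x ∈ ⨆ n : ℕ, Module.End.eigenspace D ((n : k) + 1) := by
    intro x
    induction x using FreeLie.induction with
    | zero => exact Submodule.zero_mem _
    | add x y hx hy => exact Submodule.add_mem _ hx hy
    | smul r x hx => exact Submodule.smul_mem _ r hx
    | of v =>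
      refine Submodule.mem_iSup_of_mem 0 (Module.End.mem_eigenspace_iff.2 ?_)
      rw [hof, Nat.cast_zero, zero_add, one_smul]
    | lie x y hx hy =>
      induction hx using Submodule.iSup_induction' with
      | zero => rw [zero_lie]; exact Submodule.zero_mem _
      | add a b _ _ ha hb => rw [add_lie]; exact Submodule.add_mem _ ha hb
      | mem m a ha =>
        induction hy using Submodule.iSup_induction' with
        | zero => rw [lie_zero]; exact Submodule.zero_mem _
        | add b c _ _ hb hc => rw [lie_add]; exact Submodule.add_mem _ hb hc
        | mem n b hb =>
          refine Submodule.mem_iSup_of_mem (m + n + 1) (Module.End.mem_eigenspace_iff.2 ?_)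
          rw [Module.End.mem_eigenspace_iff] at ha hb
          rw [hD, ha, hb, smul_lie, lie_smul, ← add_smul]
          congr 1
          push_cast
          ring
  rw [← LinearMap.ker_eq_bot, ← Module.End.eigenspace_zero, eq_bot_iff]
  intro x hx
  -- The kernel is the eigenspace of 0, which is independent of the eigenspaces of nonzero
  -- eigenvalues; in characteristic zero `n + 1` is nonzero.
  have hdisj := iSupIndep_def.1 (Module.End.eigenspaces_iSupIndep D) 0
  refine Submodule.disjoint_def.1 hdisj x hx ?_
  refine (iSup_le fun n => ?_ : (⨆ n : ℕ, Module.End.eigenspace D ((n : k) + 1)) ≤ _) (htop x)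
  exact le_iSup₂_of_le ((n : k) + 1) (Nat.cast_add_one_ne_zero n) le_rfl

attribute [local instance] Tr.lieRing Tr.lieAlgebra

theorem toTrees_injective : Function.Injective (toTrees k (V := V)) := by
  have h := FreeLie.injective_of_derivation (ofTrees k V ∘ₗ (toTrees k (V := V)).toLinearMap)
    ofTrees_toTrees_lie fun v => by
      rw [LinearMap.comp_apply, LieHom.coe_toLinearMap, toTrees_of, ofTrees_vertex]
  exact fun x y hxy => h (congrArg (ofTrees k V) hxy)

variable (k V) in
/-- The isomorphism between the free Lie algebra and the kernel of `δ`. -/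
def freeLieEquiv : FreeLie k V ≃ₗ[k] LinearMap.ker (delta k V) :=
  LinearEquiv.ofBijective ((toTrees k (V := V)).toLinearMap.codRestrict _ delta_toTrees)
    ⟨fun x y h => toTrees_injective (congrArg Subtype.val h), fun y => by
      obtain ⟨x, hx⟩ := mem_range_of_delta_eq_zero (LinearMap.mem_ker.1 y.2)
      exact ⟨x, Subtype.ext hx⟩⟩

end Injectivity

end LieTrees

end

/-! ### The natural isomorphism. -/

theorem mainTheorem2 (k : Type u) [Field k] [CharZero k] :
    ∃ Φ : ∀ (V : Type v) [AddCommGroup V] [Module k V],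
        LieTrees.FreeLie k V ≃ₗ[k] LinearMap.ker (LieTrees.delta k V),
      (∀ (V W : Type v) [AddCommGroup V] [Module k V] [AddCommGroup W] [Module k W]
        (f : V →ₗ[k] W) (x : LieTrees.FreeLie k V),
        (Φ W (LieTrees.FreeLie.map k f x) : LieTrees.Tr k W) =
          LieTrees.Tr.map k f (Φ V x : LieTrees.Tr k V)) ∧
      (∀ (V : Type v) [AddCommGroup V] [Module k V] (x : V),
        (Φ V (LieTrees.FreeLie.of k x) : LieTrees.Tr k V) = LieTrees.Tr.vertex k x) ∧
      (∀ (V : Type v) [AddCommGroup V] [Module k V] (x y : LieTrees.FreeLie k V),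
        (Φ V ⁅x, y⁆ : LieTrees.Tr k V) =
          LieTrees.star k V (Φ V x) (Φ V y) - LieTrees.star k V (Φ V y) (Φ V x)) :=
  ⟨fun V _ _ => LieTrees.freeLieEquiv k V,
    fun _ _ _ _ _ _ f x => LieTrees.toTrees_map k f x,
    fun _ _ _ x => LieTrees.toTrees_of k x,
    fun _ _ _ x y => LieTrees.toTrees_lie k x y⟩
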